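/- Let $\beta\in(0,1)$ and let $w,b\ge 1$ be integers. Let $\Delta_1,\Delta_2,\dots$ be i.i.d. with the geometric law $P(\Delta_i=k)=\beta(1-\beta)^{k-1}$, $k\ge1$, and let $T_j=\Delta_1+\dots+\Delta_j$. Consider the two-colour Pólya urn with immigration: it starts with $w$ white and $b$ black balls; at step $n$, if $n\in\{T_1,T_2,\dots\}$, a black ball is added; otherwise, conditionally on $(\Delta_i)_{i\ge1}$ and on the past of the urn, a ball is drawn uniformly at random from the urn and put back together with another ball of the same colour. Let $D_w(n)$ be the number of white balls after $n$ steps. For $\sigma\in(0,1)$ let $\mathcal Z_\sigma$ be the positive $\sigma$-stable variable, with $\mathbb E[e^{-\lambda \mathcal Z_\sigma}]=e^{-\lambda^\sigma}$ for $\lambda\ge0$, and density $f_\sigma$. For $\theta>-\sigma$ let $\mathcal Z_{\sigma,\theta}$ have density proportional to $z^{-\theta}f_\sigma(z)$, and let $\mathcal M_{\sigma,\theta}=\mathcal Z_{\sigma,\theta}^{-\sigma}$; its law is the generalized Mittag–Leffler law $\mathrm{ML}(\sigma,\theta)$. Let $\mathcal B_{a,c}$ and $\mathcal G_a$ denote $\mathrm{Beta}(a,c)$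 and $\mathrm{Gamma}(a,1)$ variables. Then there is a random variable $\xi$ such that $n^{-(1-\beta)}D_w(n)\to\xi$ almost surely as $n\to\infty$, and $$\xi\overset{d}{=}\mathcal B_{w,b}\,\mathcal B_{w+b,(w+b-1)\frac{\beta}{1-\beta}}\,\mathcal M_{1-\beta,w+b-1},$$ $$\xi\overset{d}{=}\mathcal B_{w,\frac{(w-1)\beta+b}{1-\beta}}\,\mathcal M_{1-\beta,w+b-1},\qquad \xi\overset{d}{=}\mathcal B_{w,\frac{w\beta+b}{1-\beta}}\,\mathcal M_{1-\beta,w+b},\qquad \xi\,\mathcal G_{w+b}^{1-\beta}\overset{d}{=}\mathcal G_w,$$ where the factors in each product are mutually independent. -/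

import Mathlib

open MeasureTheory ProbabilityTheory Filter Topology

/-- The law of a geometric variable on `{1, 2, 3, …}` with success probability `β`, that is
`P(Δ = k) = β (1 - β) ^ (k - 1)` for `k ≥ 1`. Mathlib's geometric law lives on `{0, 1, 2, …}`. -/
noncomputable def geomLaw (β : unitInterval) : Measure ℕ :=
  (geometricMeasure β).map (fun k => k + 1)

/-- The set `{T_1, T_2, …}` of immigration times, where `T_j` is the sum of the first `j`
interarrival times. The interarrival times are listed as `Δ 0, Δ 1, …`. -/
def immigrationTimes {Ω : Type*} (Δ : ℕ → Ω → ℕ) (ω : Ω) : Set ℕ :=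
  {n | ∃ j : ℕ, n = ∑ i ∈ Finset.range (j + 1), Δ i ω}

/-- The σ-algebra generated by all interarrival times and by the composition of the urn
after each of the steps `0, …, n`. -/
@[reducible]
def urnHistory {Ω : Type*} (Δ W B : ℕ → Ω → ℕ) (n : ℕ) : MeasurableSpace Ω :=
  (⨆ i : ℕ, MeasurableSpace.comap (Δ i) inferInstance) ⊔
    ⨆ k ∈ Set.Iic n,
      (MeasurableSpace.comap (W k) inferInstance ⊔ MeasurableSpace.comap (B k) inferInstance)

/-- The two-colour Pólya urn with immigration, started with `w` white and `b` black balls, where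
`W n` and `B n` are the numbers of white and black balls after `n` steps and `Δ` is the sequence
of interarrival times, drawn i.i.d. from the law `ν`.
At a step that is an immigration time a black ball is added. At every other step a ball is drawn
uniformly from the urn and put back with another ball of the same colour: given all interarrival
times and the past of the urn, a white ball is drawn with probability `W n / (W n + B n)`. -/
structure IsImmigrationUrn {Ω : Type*} [MeasurableSpace Ω] (μ : Measure Ω) (ν : Measure ℕ)
    (w b : ℕ) (Δ W B : ℕ → Ω → ℕ) : Prop where
  measurable_interarrival : ∀ i, Measurable (Δ i)
  measurable_white : ∀ n, Measurable (W n)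
  measurable_black : ∀ n, Measurable (B n)
  interarrival_law : ∀ i, μ.map (Δ i) = ν
  interarrival_indep : iIndepFun Δ μ
  initial : ∀ᵐ ω ∂μ, W 0 ω = w ∧ B 0 ω = b
  immigration_step : ∀ n, ∀ᵐ ω ∂μ, n + 1 ∈ immigrationTimes Δ ω →
    W (n + 1) ω = W n ω ∧ B (n + 1) ω = B n ω + 1
  draw_step : ∀ n, ∀ᵐ ω ∂μ, n + 1 ∉ immigrationTimes Δ ω →
    (W (n + 1) ω = W n ω + 1 ∧ B (n + 1) ω = B n ω) ∨
      (W (n + 1) ω = W n ω ∧ B (n + 1) ω = B n ω + 1)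
  draw_prob : ∀ n,
    μ[{ω | W (n + 1) ω = W n ω + 1}.indicator (fun _ => (1 : ℝ)) | urnHistory Δ W B n] =ᵐ[μ]
      {ω | n + 1 ∉ immigrationTimes Δ ω}.indicator
        (fun ω => (W n ω : ℝ) / ((W n ω : ℝ) + (B n ω : ℝ)))

/-- `ν` is the law of a positive `σ`-stable random variable `Z`, with Laplace transform
`E[exp (-lam * Z)] = exp (-lam ^ σ)` for `lam ≥ 0`. -/
structure IsPositiveStable (σ : ℝ) (ν : Measure ℝ) : Prop where
  isProbabilityMeasure : IsProbabilityMeasure ν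
  pos : ∀ᵐ z ∂ν, 0 < z
  laplace : ∀ lam : ℝ, 0 ≤ lam → ∫ z, Real.exp (-(lam * z)) ∂ν = Real.exp (-(lam ^ σ))

open Classical in
/-- The law of the positive `σ`-stable variable, that is the probability measure on `(0, ∞)` that
is characterized by its Laplace transform. (A probability measure on `(0, ∞)` is determined by its
Laplace transform, and one with this transform exists for `0 < σ < 1`; the default value is the
zero measure, which is not a probability measure.) -/
noncomputable def positiveStableLaw (σ : ℝ) : Measure ℝ :=
  if h : ∃ ν : Measure ℝ, IsPositiveStable σ ν then h.choose else 0

/-- The law of `Z_{σ,θ}`: the probability measure whose density is proportional to `z ^ (-θ)` times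
the density of the positive `σ`-stable law. -/
noncomputable def tiltedStableLaw (σ θ : ℝ) : Measure ℝ :=
  (∫⁻ z, ENNReal.ofReal (z ^ (-θ)) ∂(positiveStableLaw σ))⁻¹ •
    (positiveStableLaw σ).withDensity (fun z => ENNReal.ofReal (z ^ (-θ)))

/-- The generalized Mittag-Leffler law `ML(σ, θ)`: the law of `Z_{σ,θ} ^ (-σ)`. -/
noncomputable def mittagLefflerLaw (σ θ : ℝ) : Measure ℝ :=
  (tiltedStableLaw σ θ).map (fun z => z ^ (-σ))

/-!
The number of white balls is a Markov chain on its own. The steps that are not immigration times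
form a Bernoulli process of parameter `σ = 1 - β`, because the interarrival times are memoryless
(`measureReal_lt_inter_notMem_immigrationTimes`), and the urn up to time `n` is independent of the
immigration after time `n` (`IsImmigrationUrn.indep_whiteFiltration`). So, with `s = w + b`, given
the past of the white balls alone, a white ball is added at step `n + 1` with probability
`σ * W n / (n + s)` (`IsImmigrationUrn.isLinearGrowth`).

For such a chain the rising factorials `W n (W n + 1) ⋯ (W n + k - 1)` are martingales up to the
deterministic factors `∏ j < n, (1 + σ k / (j + s))`, which grow like
`Γ(s) / Γ(s + σ k) * n ^ (σ k)` by Euler's limit formula. The case `k = 1` gives the almost sure limit `ξ` of `n ^ (-σ) * W n`, and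
all `k` together give its moments
`E ξ ^ k = Γ(w + k) / Γ(w) * Γ(s) / Γ(s + σ k)` (`IsLinearGrowth.hasMoments_limit`).
These determine the law of `ξ`, since it has an exponential moment (`HasMoments.ext`), and the four
identities in law are then identities between Gamma functions, once the moments of Beta, Gamma and
Mittag-Leffler laws are known.

The Mittag-Leffler moments are negative moments of the positive stable law, obtained by integrating
its Laplace transform against powers (`IsPositiveStable.lintegral_rpow_neg`). That the positive
stable law exists at all is proved with the same tools (`exists_isPositiveStable`). The chain with
`w = s = 1` is built from independent uniform variables; its limit `M` has moments
`k! / Γ(1 + σ k)`, so that `M * 𝒢 ^ σ` is standard exponential when `𝒢` is an independent standard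
exponential variable. Reading this off from the tails says that `M ^ (-1 / σ)` has Laplace transform
`exp (-lam ^ σ)`.
-/

/-! ### Laws determined by their moments; Beta and Gamma laws -/

/-- `μ` is a probability measure on `[0, ∞)` whose `k`-th moment is `m k`. The moments are
Lebesgue integrals with values in `[0, ∞]`, so their finiteness is part of the claim;
a negative `m k` counts as `0`. -/
structure HasMoments (μ : Measure ℝ) (m : ℕ → ℝ) : Prop where
  isProbabilityMeasure : IsProbabilityMeasure μ
  ae_nonneg : ∀ᵐ x ∂μ, 0 ≤ x
  lintegral_pow : ∀ k, ∫⁻ x, ENNReal.ofReal x ^ k ∂μ = ENNReal.ofReal (m k)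

namespace HasMoments

variable {μ ν : Measure ℝ} {m m' : ℕ → ℝ}

lemma congr (h : HasMoments μ m) (hm : ∀ k, m k = m' k) : HasMoments μ m' := by
  rwa [← funext hm]

lemma mconv (h : HasMoments μ m) (h' : HasMoments ν m') (hm : ∀ k, 0 ≤ m k) :
    HasMoments (μ.mconv ν) (fun k => m k * m' k) := by
  have := h.isProbabilityMeasure
  have := h'.isProbabilityMeasure
  refine ⟨inferInstance, ?_, fun k => ?_⟩
  · rw [Measure.mconv, ae_map_iff (by fun_prop) measurableSet_Ici]
    filter_upwards [Measure.quasiMeasurePreserving_fst.ae h.ae_nonneg,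
      Measure.quasiMeasurePreserving_snd.ae h'.ae_nonneg] with x h1 h2
    exact mul_nonneg h1 h2
  · rw [Measure.lintegral_mconv_eq_lintegral_prod (by fun_prop), ENNReal.ofReal_mul (hm k),
      ← h.lintegral_pow, ← h'.lintegral_pow,
      ← lintegral_prod_mul (by fun_prop) (by fun_prop)]
    refine lintegral_congr_ae ?_
    filter_upwards [Measure.quasiMeasurePreserving_fst.ae h.ae_nonneg] with x h1
    rw [ENNReal.ofReal_mul h1, mul_pow]

lemma integral_pow_eq (h : HasMoments μ m) (h' : HasMoments ν m) (k : ℕ) :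
    ∫ x, x ^ k ∂μ = ∫ x, x ^ k ∂ν := by
  have key : ∀ {ρ : Measure ℝ}, HasMoments ρ m →
      ∫ x, x ^ k ∂ρ = (ENNReal.ofReal (m k)).toReal := fun {ρ} hρ => by
    rw [integral_eq_lintegral_of_nonneg_ae, ← hρ.lintegral_pow k]
    · congr 1
      refine lintegral_congr_ae ?_
      filter_upwards [hρ.ae_nonneg] with x hx
      rw [ENNReal.ofReal_pow hx]
    · filter_upwards [hρ.ae_nonneg] with x hx
      exact pow_nonneg hx k
    · fun_prop
  rw [key h, key h']

lemma integrable_exp (h : HasMoments μ m) {t : ℝ} (ht : 0 ≤ t)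
    (hs : Summable fun k => t ^ k / k.factorial * m k) :
    Integrable (fun x => Real.exp (t * x)) μ := by
  refine ⟨by fun_prop, ?_⟩
  rw [hasFiniteIntegral_iff_ofReal (by filter_upwards with x using (Real.exp_pos _).le)]
  have h1 : ∫⁻ x, ENNReal.ofReal (Real.exp (t * x)) ∂μ
      = ∫⁻ x, ∑' k : ℕ, ENNReal.ofReal (t ^ k / k.factorial) * ENNReal.ofReal x ^ k ∂μ := by
    refine lintegral_congr_ae ?_
    filter_upwards [h.ae_nonneg] with x hx
    have hexp := NormedSpace.expSeries_div_hasSum_exp (t * x)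
    rw [← Real.exp_eq_exp_ℝ] at hexp
    rw [← hexp.tsum_eq, ENNReal.ofReal_tsum_of_nonneg (fun k => by positivity) hexp.summable]
    refine tsum_congr fun k => ?_
    rw [← ENNReal.ofReal_pow hx, ← ENNReal.ofReal_mul (by positivity)]
    congr 1
    ring
  rw [h1, lintegral_tsum (fun k => by fun_prop)]
  have h2 : ∀ k : ℕ, ∫⁻ x, ENNReal.ofReal (t ^ k / k.factorial) * ENNReal.ofReal x ^ k ∂μ
      = ENNReal.ofReal (t ^ k / k.factorial * m k) := fun k => by
    rw [lintegral_const_mul _ (by fun_prop), h.lintegral_pow, ENNReal.ofReal_mul (by positivity)]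
  rw [tsum_congr h2]
  exact hs.tsum_ofReal_lt_top

lemma mem_integrableExpSet (h : HasMoments μ m) {t : ℝ} (ht : 0 ≤ t)
    (hs : Summable fun k => t ^ k / k.factorial * m k) {u : ℝ} (hu : u ≤ t) :
    u ∈ integrableExpSet id μ := by
  refine (h.integrable_exp ht hs).mono' (by fun_prop) ?_
  filter_upwards [h.ae_nonneg] with x hx
  rw [Real.norm_eq_abs, Real.abs_exp]
  exact Real.exp_le_exp.2 (mul_le_mul_of_nonneg_right hu hx)

/-- A law on `[0, ∞)` with some finite positive exponential moment is determined by its moments: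
the complex moment generating functions have equal derivatives at `0`, hence agree on a vertical
strip around the imaginary axis, where they are the characteristic functions. -/
theorem ext (h : HasMoments μ m) (h' : HasMoments ν m) {t : ℝ} (ht : 0 < t)
    (hs : Summable fun k => t ^ k / k.factorial * m k) : μ = ν := by
  have := h.isProbabilityMeasure
  have := h'.isProbabilityMeasure
  have hsub : ∀ {ρ : Measure ℝ}, HasMoments ρ m →
      Set.Iio t ⊆ interior (integrableExpSet id ρ) := fun {ρ} hρ =>
    interior_maximal (fun u hu => hρ.mem_integrableExpSet ht.le hs (le_of_lt hu)) isOpen_Iio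
  have hser : HasFPowerSeriesAt (complexMGF id ν)
      (FormalMultilinearSeries.ofScalars ℂ
        fun n => iteratedDeriv n (complexMGF id μ) 0 / n.factorial) 0 := by
    have e : ∀ n, iteratedDeriv n (complexMGF id μ) 0 = iteratedDeriv n (complexMGF id ν) 0 := by
      intro n
      rw [iteratedDeriv_complexMGF (hsub h (by simpa using ht)),
        iteratedDeriv_complexMGF (hsub h' (by simpa using ht))]
      have := h.integral_pow_eq h' n
      simp only [id, zero_mul, Complex.exp_zero, mul_one]
      have hc : ∀ ρ : Measure ℝ, ∫ x : ℝ, (x : ℂ) ^ n ∂ρ = ((∫ x : ℝ, x ^ n ∂ρ : ℝ) : ℂ) :=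
        fun ρ => by rw [← integral_complex_ofReal]; simp
      rw [hc, hc, this]
    simp_rw [e]
    exact (analyticAt_complexMGF (hsub h' (by simpa using ht))).hasFPowerSeriesAt
  have hser' := (analyticAt_complexMGF (z := 0) (hsub h (by simpa using ht))).hasFPowerSeriesAt
  have hev : complexMGF id μ =ᶠ[𝓝 0] complexMGF id ν := by
    have h1 := hser.eventually_hasSum_sub
    have h2 := hser'.eventually_hasSum_sub
    filter_upwards [h1, h2] with z hz1 hz2
    exact hz2.unique hz1
  have hpre : IsPreconnected {z : ℂ | z.re ∈ Set.Iio t} :=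
    ((convex_Iio t).linear_preimage Complex.reLm).isPreconnected
  have heq := AnalyticOnNhd.eqOn_of_preconnected_of_eventuallyEq
    (fun z hz => analyticAt_complexMGF (hsub h hz))
    (fun z hz => analyticAt_complexMGF (hsub h' hz)) hpre (z₀ := 0)
    (show (0 : ℂ).re < t by simpa using ht) hev
  refine Measure.ext_of_charFun (funext fun u => ?_)
  rw [← complexMGF_id_mul_I, ← complexMGF_id_mul_I]
  exact heq (show ((u : ℂ) * Complex.I).re < t by simpa using ht)

end HasMoments

/-- The Mellin transform of a gamma density. -/
lemma lintegral_gammaMeasure_rpow {a p : ℝ} (ha : 0 < a) (hp : 0 ≤ p) :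
    ∫⁻ x, ENNReal.ofReal (x ^ p) ∂(gammaMeasure a 1)
      = ENNReal.ofReal (Real.Gamma (a + p) / Real.Gamma a) := by
  have hΓ := Real.Gamma_pos_of_pos ha
  have hΓ' := Real.Gamma_pos_of_pos (add_pos_of_pos_of_nonneg ha hp)
  have h1 := lintegral_gammaPDF_eq_one (add_pos_of_pos_of_nonneg ha hp) one_pos
  rw [gammaMeasure, lintegral_withDensity_eq_lintegral_mul _
    (by unfold gammaPDF; fun_prop) (by fun_prop), ← mul_one (ENNReal.ofReal _), ← h1,
    ← lintegral_const_mul _ (by unfold gammaPDF; fun_prop)]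
  refine lintegral_congr_ae ?_
  filter_upwards [Measure.ae_ne volume (0 : ℝ)] with x hx0
  rcases lt_or_ge x 0 with hx | hx
  · simp [gammaPDF_of_neg hx]
  · have hx : 0 < x := lt_of_le_of_ne hx hx0.symm
    rw [Pi.mul_apply, gammaPDF_of_nonneg hx.le, gammaPDF_of_nonneg hx.le,
      ← ENNReal.ofReal_mul (by positivity), ← ENNReal.ofReal_mul (by positivity)]
    congr 1
    rw [show a + p - 1 = (a - 1) + p by ring, Real.rpow_add hx]
    simp only [Real.one_rpow]
    field_simp

lemma gammaMeasure_ae_pos (a : ℝ) : ∀ᵐ x ∂(gammaMeasure a 1), 0 < x := by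
  rw [gammaMeasure, ae_withDensity_iff (by unfold gammaPDF; fun_prop)]
  filter_upwards [Measure.ae_ne volume (0 : ℝ)] with x hx0 hx
  by_contra! h
  exact hx (gammaPDF_of_neg (lt_of_le_of_ne h hx0))

/-- The moments of the `σ`-th power of a `Gamma(a, 1)` variable. -/
lemma hasMoments_gammaMeasure_map_rpow {a σ : ℝ} (ha : 0 < a) (hσ : 0 ≤ σ) :
    HasMoments ((gammaMeasure a 1).map (fun x => x ^ σ))
      (fun k => Real.Gamma (a + σ * k) / Real.Gamma a) := by
  have := isProbabilityMeasure_gammaMeasure ha one_pos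
  refine ⟨Measure.isProbabilityMeasure_map (by fun_prop), ?_, fun k => ?_⟩
  · rw [ae_map_iff (by fun_prop) measurableSet_Ici]
    filter_upwards [gammaMeasure_ae_pos a] with x hx
    exact Real.rpow_nonneg hx.le _
  · rw [lintegral_map (by fun_prop) (by fun_prop),
      ← lintegral_gammaMeasure_rpow ha (by positivity)]
    refine lintegral_congr_ae ?_
    filter_upwards [gammaMeasure_ae_pos a] with x hx
    rw [← ENNReal.ofReal_pow (by positivity), Real.rpow_mul hx.le, Real.rpow_natCast]

lemma hasMoments_gammaMeasure {a : ℝ} (ha : 0 < a) :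
    HasMoments (gammaMeasure a 1) (fun k => Real.Gamma (a + k) / Real.Gamma a) := by
  have := hasMoments_gammaMeasure_map_rpow ha zero_le_one
  simpa using this

lemma hasMoments_betaMeasure {a c : ℝ} (ha : 0 < a) (hc : 0 < c) :
    HasMoments (betaMeasure a c) (fun k => Real.Gamma (a + k) * Real.Gamma (a + c)
      / (Real.Gamma a * Real.Gamma (a + c + k))) := by
  have hΓ := Real.Gamma_pos_of_pos ha
  refine ⟨isProbabilityMeasureBeta ha hc, ?_, fun k => ?_⟩
  · rw [betaMeasure, ae_withDensity_iff (by unfold betaPDF; fun_prop)]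
    filter_upwards with x hx
    by_contra! h
    exact hx (betaPDF_eq_zero_of_nonpos h.le)
  have hak : 0 < a + k := by positivity
  have h1 := lintegral_betaPDF_eq_one hak hc
  rw [betaMeasure, lintegral_withDensity_eq_lintegral_mul _
    (by unfold betaPDF; fun_prop) (by fun_prop), ← mul_one (ENNReal.ofReal _), ← h1,
    ← lintegral_const_mul _ (by unfold betaPDF; fun_prop)]
  refine lintegral_congr fun x => ?_
  rcases le_or_gt x 0 with hx | hx
  · simp [betaPDF_eq_zero_of_nonpos hx]
  rcases le_or_gt 1 x with hx1 | hx1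
  · simp [betaPDF_eq_zero_of_one_le hx1]
  have hΓc := Real.Gamma_pos_of_pos hc
  have hΓk := Real.Gamma_pos_of_pos hak
  have hΓs := Real.Gamma_pos_of_pos (add_pos ha hc)
  have hΓsk := Real.Gamma_pos_of_pos (add_pos hak hc)
  have h1x : 0 < 1 - x := by linarith
  rw [Pi.mul_apply, betaPDF_of_pos_lt_one hx hx1, betaPDF_of_pos_lt_one hx hx1,
    ← ENNReal.ofReal_pow hx.le, ← ENNReal.ofReal_mul (by unfold beta; positivity),
    ← ENNReal.ofReal_mul (by rw [show a + c + k = a + k + c by ring]; positivity)]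
  congr 1
  rw [show a + k - 1 = (a - 1) + k by ring, Real.rpow_add hx, Real.rpow_natCast,
    show a + c + k = a + k + c by ring]
  unfold beta
  field_simp

/-! ### Limits of processes with linear jump probabilities -/

section LimitOfMeans

variable {Ω : Type*} [MeasurableSpace Ω] {μ : Measure Ω}

/-- Means pass to an almost sure limit if the second moments stay bounded. -/
lemma lintegral_ofReal_eq_of_tendsto [IsFiniteMeasure μ] {X : ℕ → Ω → ℝ} {Y : Ω → ℝ} {c C : ℝ}
    (hX : ∀ n ω, 0 ≤ X n ω) (hint : ∀ n, Integrable (X n) μ)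
    (hint2 : ∀ n, Integrable (fun ω => X n ω ^ 2) μ)
    (hlim : ∀ᵐ ω ∂μ, Tendsto (fun n => X n ω) atTop (𝓝 (Y ω)))
    (hmean : Tendsto (fun n => ∫ ω, X n ω ∂μ) atTop (𝓝 c))
    (hC : ∀ n, ∫ ω, X n ω ^ 2 ∂μ ≤ C) :
    ∫⁻ ω, ENNReal.ofReal (Y ω) ∂μ = ENNReal.ofReal c := by
  have hYm : AEMeasurable Y μ :=
    aemeasurable_of_tendsto_metrizable_ae atTop (fun n => (hint n).aemeasurable) hlim
  have hY0 : ∀ᵐ ω ∂μ, 0 ≤ Y ω := by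
    filter_upwards [hlim] with ω hω using ge_of_tendsto' hω fun n => hX n ω
  have hminint : ∀ (K : ℝ) (f : Ω → ℝ), 0 ≤ K → AEMeasurable f μ → (∀ᵐ ω ∂μ, 0 ≤ f ω) →
      Integrable (fun ω => min (f ω) K) μ := fun K f hK hf hf0 => by
    refine Integrable.mono' (integrable_const K) (hf.min aemeasurable_const).aestronglyMeasurable ?_
    filter_upwards [hf0] with ω hω
    rw [Real.norm_of_nonneg (le_min hω hK)]
    exact min_le_right _ _
  -- truncation at height `K` costs at most `C / K`
  have htrunc : ∀ K : ℝ, 0 < K → c - C / K ≤ ∫ ω, min (Y ω) K ∂μ ∧ ∫ ω, min (Y ω) K ∂μ ≤ c := by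
    intro K hK
    have hmin : Tendsto (fun n => ∫ ω, min (X n ω) K ∂μ) atTop (𝓝 (∫ ω, min (Y ω) K ∂μ)) := by
      refine tendsto_integral_of_dominated_convergence (fun _ => K)
        (fun n => (hminint K _ hK.le (hint n).aemeasurable (ae_of_all _ (hX n))).1)
        (integrable_const K) (fun n => ?_) ?_
      · filter_upwards with ω
        rw [Real.norm_of_nonneg (le_min (hX n ω) hK.le)]
        exact min_le_right _ _
      · filter_upwards [hlim] with ω hω using hω.min tendsto_const_nhds
    constructor
    · refine le_of_tendsto_of_tendsto' (hmean.sub_const (C / K)) hmin fun n => ?_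
      have h1 : ∫ ω, (X n ω - X n ω ^ 2 / K) ∂μ ≤ ∫ ω, min (X n ω) K ∂μ := by
        refine integral_mono ((hint n).sub ((hint2 n).div_const K))
          (hminint K _ hK.le (hint n).aemeasurable (ae_of_all _ (hX n))) fun ω => ?_
        have h0 := hX n ω
        refine le_min (sub_le_self _ (by positivity)) ?_
        rw [sub_le_iff_le_add, ← sub_le_iff_le_add', le_div_iff₀ hK]
        nlinarith [sq_nonneg (X n ω - K)]
      rw [integral_sub (hint n) ((hint2 n).div_const K), integral_div] at h1
      have : (∫ ω, X n ω ^ 2 ∂μ) / K ≤ C / K := by gcongr; exact hC n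
      linarith
    · refine le_of_tendsto_of_tendsto' hmin hmean fun n => ?_
      exact integral_mono (hminint K _ hK.le (hint n).aemeasurable (ae_of_all _ (hX n)))
        (hint n) fun ω => min_le_left _ _
  have hlim1 : Tendsto (fun N : ℕ => ∫ ω, min (Y ω) ((N : ℝ) + 1) ∂μ) atTop (𝓝 c) := by
    refine tendsto_of_tendsto_of_tendsto_of_le_of_le
      (g := fun N : ℕ => c - C / ((N : ℝ) + 1)) ?_ tendsto_const_nhds
      (fun N => (htrunc _ (by positivity)).1) (fun N => (htrunc _ (by positivity)).2)
    have : Tendsto (fun N : ℕ => C * (1 / ((N : ℝ) + 1))) atTop (𝓝 (C * 0)) :=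
      tendsto_one_div_add_atTop_nhds_zero_nat.const_mul C
    simpa [div_eq_mul_inv] using this.const_sub c
  have hlim2 : Tendsto (fun N : ℕ => ∫⁻ ω, ENNReal.ofReal (min (Y ω) ((N : ℝ) + 1)) ∂μ) atTop
      (𝓝 (∫⁻ ω, ENNReal.ofReal (Y ω) ∂μ)) := by
    refine lintegral_tendsto_of_tendsto_of_monotone
      (fun N => (hYm.min aemeasurable_const).ennreal_ofReal) ?_ ?_
    · filter_upwards with ω N N' hN
      exact ENNReal.ofReal_le_ofReal (min_le_min_left _ (by gcongr))
    · filter_upwards with ω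
      refine tendsto_const_nhds.congr' ?_
      filter_upwards [eventually_ge_atTop ⌈Y ω⌉₊] with N hN
      rw [min_eq_left]
      exact ((Nat.le_ceil _).trans (Nat.cast_le.2 hN)).trans (by linarith)
  refine tendsto_nhds_unique hlim2 ?_
  refine ((ENNReal.continuous_ofReal.tendsto c).comp hlim1).congr fun N => ?_
  rw [Function.comp_apply, ofReal_integral_eq_lintegral_ofReal
    (hminint _ _ (by positivity) hYm hY0)]
  filter_upwards [hY0] with ω hω using le_min hω (by positivity)

end LimitOfMeans

/-- The asymptotics of the products of Gamma quotients that occur as means, from Euler's limit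
formula. -/
lemma tendsto_prod_one_add_div {s a : ℝ} (hs : 0 < s) (ha : 0 ≤ a) :
    Tendsto (fun n : ℕ => (n : ℝ) ^ (-a) * ∏ j ∈ Finset.range n, (1 + a / (j + s))) atTop
      (𝓝 (Real.Gamma s / Real.Gamma (s + a))) := by
  have hΓ := (Real.Gamma_pos_of_pos (add_pos_of_pos_of_nonneg hs ha)).ne'
  have h1 := (Real.GammaSeq_tendsto_Gamma s).div (Real.GammaSeq_tendsto_Gamma (s + a)) hΓ
  have h2 : Tendsto (fun n : ℕ => (1 + a / (n + s))⁻¹) atTop (𝓝 1) := by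
    have : Tendsto (fun n : ℕ => a / ((n : ℝ) + s)) atTop (𝓝 0) :=
      tendsto_const_nhds.div_atTop (tendsto_atTop_add_const_right _ _ tendsto_natCast_atTop_atTop)
    simpa using (this.const_add 1).inv₀ (by norm_num)
  have h3 := h1.mul h2
  rw [mul_one] at h3
  refine h3.congr' ?_
  filter_upwards [eventually_gt_atTop 0] with n hn
  have hn' : (0 : ℝ) < n := by exact_mod_cast hn
  have hp : ∀ j ∈ Finset.range (n + 1), 1 + a / (j + s) = (s + a + j) / (s + j) := fun j _ => by
    have : (0 : ℝ) < j + s := by positivity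
    rw [add_comm s j]
    field_simp
    ring
  have h4 : ∏ j ∈ Finset.range n, (1 + a / (j + s))
      = (∏ j ∈ Finset.range (n + 1), (s + a + j)) / (∏ j ∈ Finset.range (n + 1), (s + (j : ℝ)))
        * (1 + a / (n + s))⁻¹ := by
    have : (0 : ℝ) < 1 + a / (n + s) := by positivity
    rw [← Finset.prod_div_distrib, ← Finset.prod_congr rfl hp, Finset.prod_range_succ,
      mul_inv_cancel_right₀ this.ne']
  have h5 : (0 : ℝ) < ∏ j ∈ Finset.range (n + 1), (s + (j : ℝ)) :=
    Finset.prod_pos fun j _ => by positivity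
  have h6 : (0 : ℝ) < ∏ j ∈ Finset.range (n + 1), (s + a + (j : ℝ)) :=
    Finset.prod_pos fun j _ => by positivity
  rw [h4, ← mul_assoc]
  congr 1
  rw [Pi.div_apply, Real.GammaSeq, Real.GammaSeq, Real.rpow_add hn', Real.rpow_neg hn'.le]
  have := Real.rpow_pos_of_pos hn' s
  have := Real.rpow_pos_of_pos hn' a
  have : (0 : ℝ) < n.factorial := by positivity
  field_simp

lemma Gamma_add_div_Gamma {w : ℕ} (hw : 0 < w) (k : ℕ) :
    Real.Gamma (w + k) / Real.Gamma w = (w.ascFactorial k : ℝ) := by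
  have hw' : (0 : ℝ) < w := by exact_mod_cast hw
  rw [div_eq_iff (Real.Gamma_pos_of_pos hw').ne']
  induction k with
  | zero => simp
  | succ k ih =>
    rw [Nat.cast_succ, ← add_assoc, Real.Gamma_add_one (by positivity), ih,
      Nat.ascFactorial_succ]
    push_cast
    ring

/-- An integer-valued process that starts from `w` and, given the past up to time `n`, increases by
`1` with probability `σ * W n / (n + s)` and stays put otherwise. -/
structure IsLinearGrowth {Ω : Type*} [m : MeasurableSpace Ω] (μ : Measure Ω)
    (𝒢 : Filtration ℕ m) (σ s : ℝ) (w : ℕ) (W : ℕ → Ω → ℕ) : Prop where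
  adapted : ∀ n, Measurable[𝒢 n] (W n)
  initial : ∀ᵐ ω ∂μ, W 0 ω = w
  step : ∀ n, ∀ᵐ ω ∂μ, W (n + 1) ω = W n ω + 1 ∨ W (n + 1) ω = W n ω
  step_prob : ∀ n,
    μ[{ω | W (n + 1) ω = W n ω + 1}.indicator (fun _ => (1 : ℝ)) | 𝒢 n] =ᵐ[μ]
      fun ω => σ * W n ω / (n + s)

namespace IsLinearGrowth

variable {Ω : Type*} [m : MeasurableSpace Ω] {μ : Measure Ω}
  {𝒢 : Filtration ℕ m} {σ s : ℝ} {w : ℕ} {W : ℕ → Ω → ℕ}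

lemma measurable (h : IsLinearGrowth μ 𝒢 σ s w W) (n : ℕ) : Measurable (W n) :=
  (h.adapted n).mono (𝒢.le n) le_rfl

lemma ae_le (h : IsLinearGrowth μ 𝒢 σ s w W) (n : ℕ) : ∀ᵐ ω ∂μ, W n ω ≤ w + n := by
  induction n with
  | zero => filter_upwards [h.initial] with ω hω using hω.le
  | succ n ih =>
    filter_upwards [ih, h.step n] with ω h1 h2
    omega

variable [IsProbabilityMeasure μ]

lemma integrable_comp (h : IsLinearGrowth μ 𝒢 σ s w W) (f : ℕ → ℝ) (n : ℕ) :
    Integrable (fun ω => f (W n ω)) μ := by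
  have hm : Measurable (fun ω => f (W n ω)) := (measurable_of_countable f).comp (h.measurable n)
  refine Integrable.mono' (integrable_const (∑ j ∈ Finset.range (w + n + 1), |f j|))
    hm.aestronglyMeasurable ?_
  filter_upwards [h.ae_le n] with ω hω
  exact Finset.single_le_sum (f := fun j => |f j|) (fun j _ => abs_nonneg _)
    (Finset.mem_range.2 (by omega))

/-- Rising factorials of the process are martingales up to deterministic factors. -/
lemma condExp_ascFactorial (h : IsLinearGrowth μ 𝒢 σ s w W) (k n : ℕ) :
    μ[fun ω => ((W (n + 1) ω).ascFactorial k : ℝ) | 𝒢 n] =ᵐ[μ]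
      fun ω => (1 + σ * k / (n + s)) * ((W n ω).ascFactorial k : ℝ) := by
  set D : Set Ω := {ω | W (n + 1) ω = W n ω + 1} with hD
  have hDm : MeasurableSet D := measurableSet_eq_fun (h.measurable (n + 1))
    ((measurable_of_countable (· + 1)).comp (h.measurable n))
  let g : ℕ → ℝ := fun x => ((x + 1).ascFactorial k : ℝ) - (x.ascFactorial k : ℝ)
  have hgm : StronglyMeasurable[𝒢 n] (fun ω => g (W n ω)) :=
    ((measurable_of_countable g).comp (h.adapted n)).stronglyMeasurable
  have hfm : StronglyMeasurable[𝒢 n] (fun ω => ((W n ω).ascFactorial k : ℝ)) :=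
    ((measurable_of_countable (fun x : ℕ => (x.ascFactorial k : ℝ))).comp
      (h.adapted n)).stronglyMeasurable
  have hDint : Integrable (D.indicator (fun _ => (1 : ℝ))) μ :=
    (integrable_const 1).indicator hDm
  have hgDint : Integrable ((fun ω => g (W n ω)) * D.indicator (fun _ => (1 : ℝ))) μ := by
    refine (h.integrable_comp g n).mono
      ((h.integrable_comp g n).aestronglyMeasurable.mul hDint.aestronglyMeasurable) ?_
    filter_upwards with ω
    by_cases hω : ω ∈ D <;> simp [hω]
  have hdecomp : (fun ω => ((W (n + 1) ω).ascFactorial k : ℝ)) =ᵐ[μ]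
      (fun ω => ((W n ω).ascFactorial k : ℝ))
        + (fun ω => g (W n ω)) * D.indicator (fun _ => (1 : ℝ)) := by
    filter_upwards [h.step n] with ω hω
    by_cases hωD : ω ∈ D
    · have : W (n + 1) ω = W n ω + 1 := hωD
      simp [hωD, this, g]
    · have : W (n + 1) ω = W n ω := hω.resolve_left hωD
      simp [hωD, this]
  refine (condExp_congr_ae hdecomp).trans ?_
  refine (condExp_add (h.integrable_comp (fun x => (x.ascFactorial k : ℝ)) n) hgDint _).trans ?_
  have h1 := condExp_of_stronglyMeasurable (𝒢.le n) hfm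
    (h.integrable_comp (fun x => (x.ascFactorial k : ℝ)) n)
  have h2 := condExp_mul_of_stronglyMeasurable_left hgm hgDint hDint
  filter_upwards [h2, h.step_prob n] with ω h2 h3
  rw [Pi.add_apply, h1, h2, Pi.mul_apply, h3]
  have hasc : (W n ω : ℝ) * g (W n ω) = k * ((W n ω).ascFactorial k : ℝ) := by
    have e := Nat.ascFactorial_mul_ascFactorial (W n ω) 1 k
    rw [add_comm 1 k, Nat.ascFactorial_succ, Nat.ascFactorial_succ,
      Nat.ascFactorial_zero, add_zero, mul_one] at e
    have e' : (W n ω : ℝ) * ((W n ω + 1).ascFactorial k : ℝ)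
        = (W n ω + k) * ((W n ω).ascFactorial k : ℝ) := by exact_mod_cast e
    simp only [g, mul_sub, e']
    ring
  calc _ = ((W n ω).ascFactorial k : ℝ) + σ / (n + s) * (W n ω * g (W n ω)) := by ring
    _ = _ := by rw [hasc]; ring

lemma integral_ascFactorial (h : IsLinearGrowth μ 𝒢 σ s w W) (k n : ℕ) :
    ∫ ω, ((W n ω).ascFactorial k : ℝ) ∂μ
      = w.ascFactorial k * ∏ j ∈ Finset.range n, (1 + σ * k / (j + s)) := by
  induction n with
  | zero =>
    rw [integral_congr_ae (g := fun _ => (w.ascFactorial k : ℝ))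
      (by filter_upwards [h.initial] with ω hω; rw [hω])]
    simp
  | succ n ih =>
    rw [← integral_condExp (𝒢.le n), integral_congr_ae (h.condExp_ascFactorial k n),
      integral_const_mul, ih, Finset.prod_range_succ]
    ring

/-- The almost sure limit, from the convergence of the nonnegative martingale
`W n / ∏ j < n, (1 + σ / (j + s))`. -/
lemma exists_tendsto (h : IsLinearGrowth μ 𝒢 σ s w W) (hσ : 0 ≤ σ) (hs : 0 < s) :
    ∃ ξ : Ω → ℝ, Measurable ξ ∧
      ∀ᵐ ω ∂μ, Tendsto (fun n : ℕ => (n : ℝ) ^ (-σ) * (W n ω : ℝ)) atTop (𝓝 (ξ ω)) := by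
  let P : ℕ → ℝ := fun n => ∏ j ∈ Finset.range n, (1 + σ / (j + s))
  have hP : ∀ n, 0 < P n := fun n => Finset.prod_pos fun j _ => by positivity
  let M : ℕ → Ω → ℝ := fun n ω => (P n)⁻¹ * (W n ω : ℝ)
  have hMint : ∀ n, Integrable (M n) μ := fun n =>
    (h.integrable_comp (fun x => (x : ℝ)) n).const_mul _
  have hM : Martingale M 𝒢 μ := by
    refine martingale_nat (fun n => ?_) hMint fun n => ?_
    · exact ((measurable_of_countable (fun x : ℕ => (P n)⁻¹ * (x : ℝ))).comp
        (h.adapted n)).stronglyMeasurable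
    · have h1 := h.condExp_ascFactorial 1 n
      simp only [Nat.ascFactorial_succ, Nat.ascFactorial_zero, add_zero, Nat.cast_one,
        mul_one] at h1
      have h2 : μ[M (n + 1) | 𝒢 n] =ᵐ[μ] (P (n + 1))⁻¹ • μ[fun ω => (W (n + 1) ω : ℝ) | 𝒢 n] :=
        condExp_smul (P (n + 1))⁻¹ (fun ω => (W (n + 1) ω : ℝ)) _
      filter_upwards [h1, h2] with ω h1 h2
      rw [h2, Pi.smul_apply, h1, smul_eq_mul]
      simp only [M, P, Finset.prod_range_succ]
      have := hP n
      have h0 : 0 < 1 + σ / (n + s) := by positivity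
      change (P n)⁻¹ * _ = (P n * _)⁻¹ * _
      field_simp
  have hbdd : ∀ n, eLpNorm (M n) 1 μ ≤ ((w : NNReal) : ENNReal) := fun n => by
    have h1 := h.integral_ascFactorial 1 n
    simp only [Nat.ascFactorial_succ, Nat.ascFactorial_zero, add_zero, Nat.cast_one,
        mul_one] at h1
    have h0 : ∀ ω, 0 ≤ M n ω := fun ω => mul_nonneg (inv_nonneg.2 (hP n).le) (by positivity)
    rw [eLpNorm_one_eq_lintegral_enorm]
    have h2 : ∫⁻ ω, ‖M n ω‖ₑ ∂μ = ENNReal.ofReal (∫ ω, M n ω ∂μ) := by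
      rw [ofReal_integral_eq_lintegral_ofReal (hMint n) (ae_of_all _ h0)]
      exact lintegral_congr fun ω => Real.enorm_of_nonneg (h0 ω)
    rw [h2, integral_const_mul, h1]
    change ENNReal.ofReal ((P n)⁻¹ * (w * P n)) ≤ _
    rw [mul_comm, mul_inv_cancel_right₀ (hP n).ne']
    simp
  have hae : ∀ᵐ ω ∂μ, ∃ c, Tendsto (fun n : ℕ => (n : ℝ) ^ (-σ) * (W n ω : ℝ)) atTop (𝓝 c) := by
    filter_upwards [hM.submartingale.exists_ae_tendsto_of_bdd hbdd] with ω ⟨c, hc⟩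
    refine ⟨_, ((tendsto_prod_one_add_div hs hσ).mul hc).congr fun n => ?_⟩
    change (n : ℝ) ^ (-σ) * P n * ((P n)⁻¹ * (W n ω : ℝ)) = _
    have := hP n
    field_simp
  obtain ⟨ξ, hξm, hξ⟩ := measurable_limit_of_tendsto_metrizable_ae
    (fun n => ((h.integrable_comp (fun x => (x : ℝ)) n).const_mul ((n : ℝ) ^ (-σ))).aemeasurable)
    hae
  exact ⟨ξ, hξm, hξ⟩

/-- The moments of the limit are the limits of the normalized rising factorial moments. -/
lemma hasMoments_limit (h : IsLinearGrowth μ 𝒢 σ s w W) (hσ : 0 < σ) (hs : 0 < s) (hw : 0 < w)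
    {ξ : Ω → ℝ} (hξ : Measurable ξ)
    (hlim : ∀ᵐ ω ∂μ, Tendsto (fun n : ℕ => (n : ℝ) ^ (-σ) * (W n ω : ℝ)) atTop (𝓝 (ξ ω))) :
    HasMoments (μ.map ξ) (fun k => Real.Gamma (w + k) / Real.Gamma w
      * (Real.Gamma s / Real.Gamma (s + σ * k))) := by
  have hξ0 : ∀ᵐ ω ∂μ, 0 ≤ ξ ω := by
    filter_upwards [hlim] with ω hω using ge_of_tendsto' hω fun n => by positivity
  refine ⟨Measure.isProbabilityMeasure_map hξ.aemeasurable,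
    (ae_map_iff hξ.aemeasurable measurableSet_Ici).2 hξ0, fun k => ?_⟩
  rw [lintegral_map (by fun_prop) hξ]
  rw [Gamma_add_div_Gamma hw]
  let X : ℕ → Ω → ℝ := fun n ω => (n : ℝ) ^ (-(σ * k)) * ((W n ω).ascFactorial k : ℝ)
  have hX0 : ∀ n ω, 0 ≤ X n ω := fun n ω => by positivity
  have hmean : ∀ l n : ℕ, ∫ ω, (n : ℝ) ^ (-(σ * l)) * ((W n ω).ascFactorial l : ℝ) ∂μ
      = w.ascFactorial l * ((n : ℝ) ^ (-(σ * l))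
        * ∏ j ∈ Finset.range n, (1 + σ * l / (j + s))) := fun l n => by
    rw [integral_const_mul, h.integral_ascFactorial]
    ring
  have hmeanlim : ∀ l : ℕ, Tendsto
      (fun n : ℕ => ∫ ω, (n : ℝ) ^ (-(σ * l)) * ((W n ω).ascFactorial l : ℝ) ∂μ) atTop
      (𝓝 (w.ascFactorial l * (Real.Gamma s / Real.Gamma (s + σ * l)))) := fun l => by
    simp_rw [hmean l]
    exact (tendsto_prod_one_add_div hs (by positivity)).const_mul _
  obtain ⟨C, hC⟩ := (hmeanlim (k + k)).bddAbove_range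
  have hXlim : ∀ᵐ ω ∂μ, Tendsto (fun n => X n ω) atTop (𝓝 (ξ ω ^ k)) := by
    filter_upwards [hlim] with ω hω
    have hn0 : Tendsto (fun n : ℕ => (n : ℝ) ^ (-σ)) atTop (𝓝 0) :=
      (tendsto_rpow_neg_atTop hσ).comp tendsto_natCast_atTop_atTop
    have h1 : ∀ i ∈ Finset.range k,
        Tendsto (fun n : ℕ => (n : ℝ) ^ (-σ) * ((W n ω : ℝ) + i)) atTop (𝓝 (ξ ω)) := fun i _ => by
      have := hω.add (hn0.mul_const (i : ℝ))
      simpa [mul_add] using this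
    have h2 := tendsto_finsetProd (Finset.range k) h1
    rw [Finset.prod_const, Finset.card_range] at h2
    refine h2.congr fun n => ?_
    rw [Finset.prod_mul_distrib, Finset.prod_const, Finset.card_range]
    simp only [X]
    rw [Nat.ascFactorial_eq_prod_range, ← neg_mul, Real.rpow_mul (Nat.cast_nonneg n),
      Real.rpow_natCast]
    push_cast
    rfl
  have hsq : ∀ n ω, X n ω ^ 2 ≤
      (n : ℝ) ^ (-(σ * (k + k : ℕ))) * ((W n ω).ascFactorial (k + k) : ℝ) := fun n ω => by
    have e1 : ((n : ℝ) ^ (-(σ * k))) ^ 2 = (n : ℝ) ^ (-(σ * (k + k : ℕ))) := by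
      rw [← Real.rpow_natCast, ← Real.rpow_mul (Nat.cast_nonneg n)]
      congr 1
      push_cast
      ring
    have e2 : (W n ω).ascFactorial k ^ 2 ≤ (W n ω).ascFactorial (k + k) := by
      rw [← Nat.ascFactorial_mul_ascFactorial, sq]
      exact Nat.mul_le_mul_left _ (Nat.ascFactorial_le k (by omega))
    simp only [X]
    rw [mul_pow, e1]
    gcongr
    exact_mod_cast e2
  have hXint2 : ∀ n, Integrable (fun ω => X n ω ^ 2) μ := fun n =>
    h.integrable_comp (fun x => ((n : ℝ) ^ (-(σ * k)) * (x.ascFactorial k : ℝ)) ^ 2) n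
  have := lintegral_ofReal_eq_of_tendsto (C := C) hX0
    (fun n => h.integrable_comp (fun x => (n : ℝ) ^ (-(σ * k)) * (x.ascFactorial k : ℝ)) n)
    hXint2 hXlim (hmeanlim k) fun n => ?_
  · rw [← this]
    refine lintegral_congr_ae ?_
    filter_upwards [hξ0] with ω hω
    rw [ENNReal.ofReal_pow hω]
  · exact (integral_mono (hXint2 n) (h.integrable_comp (fun x =>
      (n : ℝ) ^ (-(σ * (k + k : ℕ))) * (x.ascFactorial (k + k) : ℝ)) n) (hsq n)).trans
      (hC (Set.mem_range_self n))

end IsLinearGrowth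

/-! ### The positive stable and Mittag-Leffler laws -/

/-- The process driven by a sequence `u` of uniform variables that starts from `1` and jumps at
step `n + 1` if `u n < σ * W n / (n + 1)`. -/
noncomputable def uniformGrowth (σ : ℝ) : ℕ → (ℕ → unitInterval) → ℕ
  | 0, _ => 1
  | n + 1, u => uniformGrowth σ n u +
      if (u n : ℝ) < σ * uniformGrowth σ n u / (n + 1) then 1 else 0

/-- The `σ`-algebra at time `n` of the sequence of uniform variables is generated by those with
index less than `n`. -/
def uniformFiltration : Filtration ℕ (inferInstance : MeasurableSpace (ℕ → unitInterval)) where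
  seq n := ⨆ i ∈ Set.Iio n, MeasurableSpace.comap (fun u => u i) inferInstance
  mono' _ _ h := biSup_mono fun _ hi => lt_of_lt_of_le hi h
  le' _ := iSup₂_le fun i _ => (measurable_pi_apply i).comap_le

section UniformGrowth

variable {σ : ℝ}

lemma measurable_uniformFiltration {i n : ℕ} (h : i < n) :
    Measurable[uniformFiltration n] (fun u : ℕ → unitInterval => u i) :=
  Measurable.of_comap_le (le_iSup₂_of_le i h le_rfl)

lemma measurable_uniformGrowth (n : ℕ) : Measurable[uniformFiltration n] (uniformGrowth σ n) := by
  induction n with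
  | zero => exact measurable_const
  | succ n ih =>
    have h1 : Measurable[uniformFiltration (n + 1)] (uniformGrowth σ n) :=
      ih.mono (uniformFiltration.mono n.le_succ) le_rfl
    have h2 : Measurable[uniformFiltration (n + 1)] (fun u : ℕ → unitInterval => (u n : ℝ)) :=
      measurable_subtype_coe.comp (measurable_uniformFiltration n.lt_succ_self)
    have h3 : Measurable[uniformFiltration (n + 1)]
        (fun u => σ * uniformGrowth σ n u / ((n : ℝ) + 1)) :=
      (measurable_of_countable (fun x : ℕ => σ * x / ((n : ℝ) + 1))).comp h1
    exact h1.add (Measurable.ite (measurableSet_lt h2 h3) measurable_const measurable_const)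

lemma uniformGrowth_le (n : ℕ) (u : ℕ → unitInterval) : uniformGrowth σ n u ≤ n + 1 := by
  induction n with
  | zero => exact le_rfl
  | succ n ih =>
    rw [uniformGrowth]
    split_ifs <;> omega

lemma uniformGrowth_succ_eq_add_one_iff (n : ℕ) (u : ℕ → unitInterval) :
    uniformGrowth σ (n + 1) u = uniformGrowth σ n u + 1 ↔
      (u n : ℝ) < σ * uniformGrowth σ n u / (n + 1) := by
  rw [uniformGrowth]
  split_ifs with h <;> simp [h]

lemma isLinearGrowth_uniformGrowth (hσ0 : 0 ≤ σ) (hσ1 : σ ≤ 1) :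
    IsLinearGrowth (Measure.infinitePi fun _ : ℕ => (volume : Measure unitInterval))
      uniformFiltration σ 1 1 (uniformGrowth σ) := by
  set P : Measure (ℕ → unitInterval) := Measure.infinitePi fun _ => volume with hP
  refine ⟨measurable_uniformGrowth, ae_of_all _ fun u => rfl, fun n => ae_of_all _ fun u => ?_,
    fun n => ?_⟩
  · rw [uniformGrowth]
    split_ifs <;> simp
  -- split the jump event over the values `j` of the process: it is the union of `E j ∩ A j`,
  -- where `E j` is known at time `n` and `A j` only depends on the next uniform variable
  let A : ℕ → Set (ℕ → unitInterval) := fun j => {u | (u n : ℝ) < σ * j / (n + 1)}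
  let E : ℕ → Set (ℕ → unitInterval) := fun j => {u | uniformGrowth σ n u = j}
  have hAm' : ∀ j, MeasurableSet[MeasurableSpace.comap (fun u : ℕ → unitInterval => u n)
      inferInstance] (A j) := fun j =>
    ⟨{x | (x : ℝ) < σ * j / (n + 1)}, measurableSet_lt measurable_subtype_coe measurable_const,
      rfl⟩
  have hAm : ∀ j, MeasurableSet (A j) := fun j => (measurable_pi_apply n).comap_le _ (hAm' j)
  have hEm : ∀ j, MeasurableSet[uniformFiltration n] (E j) := fun j =>
    measurable_uniformGrowth n (measurableSet_singleton j)
  have hdecomp : {u | uniformGrowth σ (n + 1) u = uniformGrowth σ n u + 1}.indicator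
      (fun _ => (1 : ℝ)) = ∑ j ∈ Finset.range (n + 2),
        (E j).indicator (fun _ => (1 : ℝ)) * (A j).indicator (fun _ => (1 : ℝ)) := by
    funext u
    rw [Finset.sum_apply, Finset.sum_eq_single (uniformGrowth σ n u)]
    · by_cases h : (u n : ℝ) < σ * uniformGrowth σ n u / (n + 1)
      · have := (uniformGrowth_succ_eq_add_one_iff n u).2 h
        simp [this, A, E, h]
      · have := mt (uniformGrowth_succ_eq_add_one_iff n u).1 h
        simp [this, A, h]
    · intro j _ hj
      have : u ∉ E j := fun h => hj h.symm
      simp [this]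
    · intro h
      exact absurd (Finset.mem_range.2 (by have := uniformGrowth_le (σ := σ) n u; omega)) h
  have hAint : ∀ j, Integrable ((A j).indicator (fun _ => (1 : ℝ))) P := fun j =>
    (integrable_const 1).indicator (hAm j)
  have hEAint : ∀ j, Integrable ((E j).indicator (fun _ => (1 : ℝ))
      * (A j).indicator (fun _ => (1 : ℝ))) P := fun j => by
    have : (E j).indicator (fun _ => (1 : ℝ)) * (A j).indicator (fun _ => (1 : ℝ))
        = (E j ∩ A j).indicator (fun _ => (1 : ℝ)) := by
      funext u
      by_cases h1 : u ∈ E j <;> by_cases h2 : u ∈ A j <;> simp [h1, h2]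
    rw [this]
    exact (integrable_const 1).indicator ((uniformFiltration.le n _ (hEm j)).inter (hAm j))
  have hindep : Indep (MeasurableSpace.comap (fun u : ℕ → unitInterval => u n) inferInstance)
      (uniformFiltration n) P := by
    have hi : iIndepFun (fun (i : ℕ) (u : ℕ → unitInterval) => u i) P :=
      iIndepFun_infinitePi (X := fun _ x => x) fun _ => measurable_id
    have := indep_iSup_of_disjoint (fun i => (measurable_pi_apply i).comap_le) hi
      (S := {n}) (T := Set.Iio n) (by simp)
    rw [iSup_singleton] at this
    exact this
  have hcond : ∀ j ∈ Finset.range (n + 2), P[(E j).indicator (fun _ => (1 : ℝ))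
      * (A j).indicator (fun _ => (1 : ℝ)) | uniformFiltration n] =ᵐ[P]
        (E j).indicator (fun _ => σ * j / (n + 1)) := by
    intro j hj
    refine (condExp_mul_of_stronglyMeasurable_left
      (stronglyMeasurable_const.indicator (hEm j)) (hEAint j) (hAint j)).trans ?_
    have h1 := condExp_indep_eq (μ := P) (measurable_pi_apply n).comap_le (uniformFiltration.le n)
      ((stronglyMeasurable_const (b := (1 : ℝ))).indicator (hAm' j)) hindep
    have hj' : (j : ℝ) ≤ n + 1 := by exact_mod_cast Nat.lt_succ_iff.1 (Finset.mem_range.1 hj)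
    have hp0 : 0 ≤ σ * j / (n + 1) := by positivity
    have hp1 : σ * j / (n + 1) ≤ 1 := by
      rw [div_le_one (by positivity)]
      nlinarith [(Nat.cast_nonneg j : (0 : ℝ) ≤ j)]
    have h2 : P[(A j).indicator (fun _ => (1 : ℝ))] = σ * j / (n + 1) := by
      rw [integral_indicator_const _ (hAm j), smul_eq_mul, mul_one, measureReal_def]
      have : A j = (fun u : ℕ → unitInterval => u n) ⁻¹'
          Set.Iio (⟨σ * j / (n + 1), hp0, hp1⟩ : unitInterval) := rfl
      rw [this, ← Measure.map_apply (measurable_pi_apply n) measurableSet_Iio,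
        Measure.infinitePi_map_eval, unitInterval.volume_Iio, ENNReal.toReal_ofReal hp0]
    filter_upwards [h1] with u hu
    rw [Pi.mul_apply, hu, h2]
    by_cases h : u ∈ E j <;> simp [h]
  rw [hdecomp]
  refine (condExp_finsetSum (fun j _ => hEAint j) _).trans ?_
  have hall : ∀ᵐ u ∂P, ∀ j ∈ Finset.range (n + 2), P[(E j).indicator (fun _ => (1 : ℝ))
      * (A j).indicator (fun _ => (1 : ℝ)) | uniformFiltration n] u
        = (E j).indicator (fun _ => σ * j / (n + 1)) u :=
    (ae_ball_iff (Finset.countable_toSet _)).2 hcond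
  filter_upwards [hall] with u hu
  rw [Finset.sum_apply, Finset.sum_congr rfl hu, Finset.sum_eq_single (uniformGrowth σ n u)]
  · simp [E]
  · intro j _ hj
    have : u ∉ E j := fun h => hj h.symm
    simp [this]
  · intro h
    exact absurd (Finset.mem_range.2 (by have := uniformGrowth_le (σ := σ) n u; omega)) h

end UniformGrowth

/-- The moments `Γ(w + k) / Γ(w)` of `Gamma(w, 1)` leave room for an
exponential moment, here of order `1 / 2`. -/
lemma summable_gamma_moments {w : ℕ} (hw : 0 < w) :
    Summable fun k : ℕ => (1 / 2 : ℝ) ^ k / k.factorial * (Real.Gamma (w + k) / Real.Gamma w) := by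
  have h := summable_choose_mul_geometric_of_norm_lt_one (w - 1) (r := (1 / 2 : ℝ))
    (by norm_num)
  refine h.congr fun k => ?_
  rw [Gamma_add_div_Gamma hw, Nat.ascFactorial_eq_factorial_mul_choose',
    show k + (w - 1) = w + k - 1 by omega, ← Nat.choose_symm (show k ≤ w + k - 1 by omega),
    show w + k - 1 - k = w - 1 by omega]
  have : (0 : ℝ) < k.factorial := by positivity
  push_cast
  field_simp

/-- Multiplication by `𝒢 ^ σ` with `𝒢` of law `Gamma(s, 1)` cancels the Gamma factors in the
moments and leaves the law `Gamma(w, 1)`. -/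
lemma HasMoments.mconv_gammaMeasure {ρ : Measure ℝ} {σ s : ℝ} {w : ℕ} (hσ : 0 ≤ σ) (hs : 0 < s)
    (hw : 0 < w)
    (h : HasMoments ρ fun k => Real.Gamma (w + k) / Real.Gamma w
      * (Real.Gamma s / Real.Gamma (s + σ * k))) :
    ρ.mconv ((gammaMeasure s 1).map (fun x => x ^ σ)) = gammaMeasure w 1 := by
  have hw' : (0 : ℝ) < w := by exact_mod_cast hw
  have hΓ : ∀ k : ℕ, 0 < Real.Gamma (s + σ * k) := fun k => Real.Gamma_pos_of_pos (by positivity)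
  have hΓw : ∀ k : ℕ, 0 < Real.Gamma (w + k) := fun k => Real.Gamma_pos_of_pos (by positivity)
  have hΓs := Real.Gamma_pos_of_pos hs
  have hΓw0 := Real.Gamma_pos_of_pos hw'
  have h1 := h.mconv (hasMoments_gammaMeasure_map_rpow hs hσ) fun k => by
    have := hΓ k
    have := hΓw k
    positivity
  refine HasMoments.ext (h1.congr fun k => ?_) (hasMoments_gammaMeasure hw')
    (t := 1 / 2) (by norm_num) (summable_gamma_moments hw)
  have := hΓ k
  field_simp

lemma gammaMeasure_one_Ioi {x : ℝ} (hx : 0 ≤ x) :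
    gammaMeasure 1 1 (Set.Ioi x) = ENNReal.ofReal (Real.exp (-x)) := by
  have : IsProbabilityMeasure (gammaMeasure 1 1) :=
    isProbabilityMeasure_gammaMeasure one_pos one_pos
  have h := cdf_expMeasure_eq one_pos x
  rw [if_pos hx, one_mul, expMeasure] at h
  rw [← Set.compl_Iic, prob_compl_eq_one_sub measurableSet_Iic, ← ofReal_cdf, h,
    ← ENNReal.ofReal_one, ← ENNReal.ofReal_sub _ (by simp [hx])]
  congr 1
  ring

/-- Existence of the positive stable law. If `M` has moments `k! / Γ(1 + σ k)` and `𝒢` is an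
independent standard exponential variable, then `M * 𝒢 ^ σ` is standard exponential, and so
`E exp (-lam * M ^ (-1 / σ)) = P(𝒢 > lam * M ^ (-1 / σ)) = P(M * 𝒢 ^ σ > lam ^ σ)
= exp (-lam ^ σ)`. Such an `M` is the normalized limit of `uniformGrowth σ`. -/
theorem exists_isPositiveStable {σ : ℝ} (hσ0 : 0 < σ) (hσ1 : σ < 1) :
    ∃ ν : Measure ℝ, IsPositiveStable σ ν := by
  have hgrow := isLinearGrowth_uniformGrowth hσ0.le hσ1.le
  obtain ⟨ξ, hξm, hξ⟩ := hgrow.exists_tendsto hσ0.le one_pos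
  have hmom := hgrow.hasMoments_limit hσ0 one_pos one_pos hξm hξ
  set ρ := (Measure.infinitePi fun _ : ℕ => (volume : Measure unitInterval)).map ξ with hρ
  have hρP := hmom.isProbabilityMeasure
  have hγP : IsProbabilityMeasure (gammaMeasure 1 1) :=
    isProbabilityMeasure_gammaMeasure one_pos one_pos
  have hexp := hmom.mconv_gammaMeasure hσ0.le one_pos one_pos
  rw [Nat.cast_one] at hexp
  have hmapP : IsProbabilityMeasure ((gammaMeasure 1 1).map (fun x : ℝ => x ^ σ)) :=
    Measure.isProbabilityMeasure_map (by fun_prop)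
  -- `M * 𝒢 ^ σ` has no atom at `0`, hence neither has `M`
  have hpos : ∀ᵐ x ∂ρ, 0 < x := by
    have h1 := gammaMeasure_ae_pos 1
    rw [← hexp, Measure.mconv, ae_map_iff (by fun_prop) measurableSet_Ioi] at h1
    filter_upwards [Measure.ae_ae_of_ae_prod h1, hmom.ae_nonneg] with x hx hx0
    obtain ⟨y, hy⟩ := hx.exists
    refine lt_of_le_of_ne hx0 fun h => ?_
    simp [← h] at hy
  refine ⟨ρ.map (fun x => x ^ (-(1 / σ))), Measure.isProbabilityMeasure_map (by fun_prop), ?_,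
    fun lam hlam => ?_⟩
  · rw [ae_map_iff (by fun_prop) measurableSet_Ioi]
    filter_upwards [hpos] with x hx using Real.rpow_pos_of_pos hx _
  rw [integral_map (by fun_prop) (by fun_prop),
    integral_eq_lintegral_of_nonneg_ae (ae_of_all _ fun x => (Real.exp_pos _).le) (by fun_prop)]
  have h2 : ∫⁻ x, ENNReal.ofReal (Real.exp (-(lam * x ^ (-(1 / σ))))) ∂ρ
      = gammaMeasure 1 1 (Set.Ioi (lam ^ σ)) := by
    rw [← hexp, ← lintegral_indicator_one measurableSet_Ioi,
      Measure.lintegral_mconv (measurable_one.indicator measurableSet_Ioi)]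
    refine lintegral_congr_ae ?_
    filter_upwards [hpos] with x hx
    have hx' : 0 ≤ x ^ (-(1 / σ)) := (Real.rpow_pos_of_pos hx _).le
    have hmap := lintegral_map (μ := gammaMeasure 1 1)
      (f := fun y => (Set.Ioi (lam ^ σ)).indicator (1 : ℝ → ENNReal) (x * y))
      ((measurable_one.indicator measurableSet_Ioi).comp (measurable_const_mul x))
      (show Measurable fun y : ℝ => y ^ σ by fun_prop)
    rw [hmap, ← gammaMeasure_one_Ioi (mul_nonneg hlam hx'),
      ← lintegral_indicator_one measurableSet_Ioi]
    refine lintegral_congr_ae ?_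
    filter_upwards [gammaMeasure_ae_pos 1] with y hy
    have hiff : lam * x ^ (-(1 / σ)) < y ↔ lam ^ σ < x * y ^ σ := by
      rw [← Real.rpow_lt_rpow_iff (mul_nonneg hlam hx') hy.le hσ0, Real.mul_rpow hlam hx',
        ← Real.rpow_mul hx.le, show -(1 / σ) * σ = -1 by field_simp, Real.rpow_neg_one,
        mul_inv_lt_iff₀ hx, mul_comm]
    simp only [Set.indicator, Set.mem_Ioi, hiff, Pi.one_apply]
  rw [h2, gammaMeasure_one_Ioi (Real.rpow_nonneg hlam σ), ENNReal.toReal_ofReal (Real.exp_pos _).le]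

lemma isPositiveStable_positiveStableLaw {σ : ℝ} (hσ0 : 0 < σ) (hσ1 : σ < 1) :
    IsPositiveStable σ (positiveStableLaw σ) := by
  have h := exists_isPositiveStable hσ0 hσ1
  rw [positiveStableLaw, dif_pos h]
  exact h.choose_spec

/-- The negative moments of the positive stable law, by integrating the Laplace transform against
`lam ^ (p - 1)`. -/
lemma IsPositiveStable.lintegral_rpow_neg {σ p : ℝ} {ν : Measure ℝ} (h : IsPositiveStable σ ν)
    (hσ : 0 < σ) (hp : 0 < p) :
    ∫⁻ z, ENNReal.ofReal (z ^ (-p)) ∂ν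
      = ENNReal.ofReal (Real.Gamma (1 + p / σ) / Real.Gamma (1 + p)) := by
  have := h.isProbabilityMeasure
  have hΓp := Real.Gamma_pos_of_pos hp
  have h1 : ∀ᵐ z ∂ν, ENNReal.ofReal (Real.Gamma p) * ENNReal.ofReal (z ^ (-p))
      = ∫⁻ l in Set.Ioi (0 : ℝ), ENNReal.ofReal (l ^ (p - 1) * Real.exp (-(z * l))) := by
    filter_upwards [h.pos] with z hz
    have hI := Real.integral_rpow_mul_exp_neg_mul_Ioi hp hz
    have hpos : 0 < (1 / z) ^ p * Real.Gamma p := by positivity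
    rw [← ofReal_integral_eq_lintegral_ofReal
      (Integrable.of_integral_ne_zero (by rw [hI]; exact hpos.ne'))
      ((ae_restrict_iff' measurableSet_Ioi).2 (ae_of_all _ fun l (hl : 0 < l) => by positivity)),
      hI, ← ENNReal.ofReal_mul hΓp.le, one_div, Real.inv_rpow hz.le, ← Real.rpow_neg hz.le,
      mul_comm]
  have h2 : ENNReal.ofReal (Real.Gamma p) * ∫⁻ z, ENNReal.ofReal (z ^ (-p)) ∂ν
      = ENNReal.ofReal (1 / σ * Real.Gamma (p / σ)) := by
    rw [← lintegral_const_mul _ (by fun_prop), lintegral_congr_ae h1,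
      lintegral_lintegral_swap (by fun_prop)]
    have hI := integral_rpow_mul_exp_neg_rpow hσ (show -1 < p - 1 by linarith)
    rw [sub_add_cancel] at hI
    have hΓ := Real.Gamma_pos_of_pos (div_pos hp hσ)
    have hpos : 0 < 1 / σ * Real.Gamma (p / σ) := by positivity
    rw [← hI, ofReal_integral_eq_lintegral_ofReal
      (Integrable.of_integral_ne_zero (by rw [hI]; exact hpos.ne'))
      ((ae_restrict_iff' measurableSet_Ioi).2 (ae_of_all _ fun l (hl : 0 < l) => by positivity))]
    refine setLIntegral_congr_fun measurableSet_Ioi fun l hl => ?_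
    have hl : 0 < l := hl
    have hL := h.laplace l hl.le
    have hLi : Integrable (fun z => Real.exp (-(l * z))) ν :=
      Integrable.of_integral_ne_zero (by rw [hL]; exact (Real.exp_pos _).ne')
    rw [ENNReal.ofReal_mul (by positivity), ← hL, ofReal_integral_eq_lintegral_ofReal hLi
      (ae_of_all _ fun z => (Real.exp_pos _).le), ← lintegral_const_mul _ (by fun_prop)]
    refine lintegral_congr fun z => ?_
    rw [ENNReal.ofReal_mul (by positivity), mul_comm z l]
  have h3 : ENNReal.ofReal (Real.Gamma (1 + p / σ) / Real.Gamma (1 + p))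
      = ENNReal.ofReal (1 / σ * Real.Gamma (p / σ)) / ENNReal.ofReal (Real.Gamma p) := by
    rw [← ENNReal.ofReal_div_of_pos hΓp]
    congr 1
    rw [add_comm 1 (p / σ), add_comm 1 p, Real.Gamma_add_one (by positivity),
      Real.Gamma_add_one hp.ne']
    field_simp
  rw [h3, ← h2, mul_comm, ENNReal.mul_div_cancel_right]
  · simpa using hΓp
  · exact ENNReal.ofReal_ne_top

/-- The moments of the generalized Mittag-Leffler law. -/
lemma hasMoments_mittagLefflerLaw {σ θ : ℝ} (hσ0 : 0 < σ) (hσ1 : σ < 1) (hθ : 0 < θ) :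
    HasMoments (mittagLefflerLaw σ θ) (fun k =>
      Real.Gamma (1 + (θ + σ * k) / σ) / Real.Gamma (1 + (θ + σ * k))
        / (Real.Gamma (1 + θ / σ) / Real.Gamma (1 + θ))) := by
  have hst := isPositiveStable_positiveStableLaw hσ0 hσ1
  have hc := hst.lintegral_rpow_neg hσ0 hθ
  have hG1 := Real.Gamma_pos_of_pos (show 0 < 1 + θ / σ by positivity)
  have hG2 := Real.Gamma_pos_of_pos (show 0 < 1 + θ by positivity)
  have hc0 : 0 < Real.Gamma (1 + θ / σ) / Real.Gamma (1 + θ) := by positivity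
  -- integration against the tilted law, with its normalizing constant computed
  have htilt : ∀ f : ℝ → ENNReal, Measurable f → ∫⁻ z, f z ∂(tiltedStableLaw σ θ)
      = (∫⁻ z, ENNReal.ofReal (z ^ (-θ)) * f z ∂(positiveStableLaw σ))
        / ENNReal.ofReal (Real.Gamma (1 + θ / σ) / Real.Gamma (1 + θ)) := fun f hf => by
    rw [tiltedStableLaw, lintegral_smul_measure, hc,
      lintegral_withDensity_eq_lintegral_mul _ (by fun_prop) hf, smul_eq_mul, mul_comm,
      ENNReal.div_eq_inv_mul, mul_comm]
    rfl
  have hPt : IsProbabilityMeasure (tiltedStableLaw σ θ) := ⟨by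
    have := htilt 1 measurable_one
    simp only [Pi.one_apply, lintegral_one, mul_one, hc] at this
    rw [this, ENNReal.div_self (by simpa using hc0) ENNReal.ofReal_ne_top]⟩
  have hpos : ∀ᵐ z ∂(tiltedStableLaw σ θ), 0 < z := by
    refine Measure.ae_smul_measure ?_ _
    exact (withDensity_absolutelyContinuous _ _).ae_le hst.pos
  refine ⟨Measure.isProbabilityMeasure_map (by fun_prop), ?_, fun k => ?_⟩
  · rw [mittagLefflerLaw, ae_map_iff (by fun_prop) measurableSet_Ici]
    filter_upwards [hpos] with z hz using Real.rpow_nonneg hz.le _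
  · rw [mittagLefflerLaw, lintegral_map (by fun_prop) (by fun_prop), htilt _ (by fun_prop),
      ENNReal.ofReal_div_of_pos hc0, ← hst.lintegral_rpow_neg (p := θ + σ * k) hσ0 (by positivity)]
    congr 1
    refine lintegral_congr_ae ?_
    filter_upwards [hst.pos] with z hz
    rw [← ENNReal.ofReal_pow (by positivity), ← ENNReal.ofReal_mul (by positivity),
      ← Real.rpow_natCast, ← Real.rpow_mul hz.le, ← Real.rpow_add hz]
    congr 2
    ring

/-! ### Immigration times as a Bernoulli process -/

section Immigration

variable {Ω : Type*}

lemma measurableSet_mem_immigrationTimes [MeasurableSpace Ω] {Δ : ℕ → Ω → ℕ}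
    (hΔ : ∀ i, Measurable (Δ i)) (n : ℕ) : MeasurableSet {ω | n ∈ immigrationTimes Δ ω} := by
  have : {ω | n ∈ immigrationTimes Δ ω}
      = ⋃ j : ℕ, {ω | n = ∑ i ∈ Finset.range (j + 1), Δ i ω} := by
    ext ω
    simp [immigrationTimes]
  rw [this]
  exact MeasurableSet.iUnion fun j => measurableSet_eq_fun measurable_const
    (Finset.measurable_sum _ fun i _ => hΔ i)

lemma le_of_mem_immigrationTimes {Δ : ℕ → Ω → ℕ} {ω : Ω} {n : ℕ}
    (h : n ∈ immigrationTimes Δ ω) : Δ 0 ω ≤ n := by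
  obtain ⟨j, rfl⟩ := h
  exact Finset.single_le_sum (f := fun i => Δ i ω) (fun _ _ => Nat.zero_le _) (by simp)

lemma mem_immigrationTimes_zero (Δ : ℕ → Ω → ℕ) (ω : Ω) : Δ 0 ω ∈ immigrationTimes Δ ω :=
  ⟨0, by simp⟩

/-- The immigration times after the first one are those of the shifted sequence of interarrival
times, seen from the first immigration time. -/
lemma add_mem_immigrationTimes_iff {Δ : ℕ → Ω → ℕ} {ω : Ω} {n : ℕ} (hn : 0 < n) :
    Δ 0 ω + n ∈ immigrationTimes Δ ω ↔ n ∈ immigrationTimes (fun i => Δ (i + 1)) ω := by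
  constructor
  · rintro ⟨j, hj⟩
    rw [Finset.sum_range_succ'] at hj
    cases j with
    | zero =>
      rw [Finset.sum_range_zero] at hj
      omega
    | succ j => exact ⟨j, by simp only; omega⟩
  · rintro ⟨j, hj⟩
    exact ⟨j + 1, by rw [Finset.sum_range_succ', hj, add_comm]⟩

variable [MeasurableSpace Ω] {μ : Measure Ω} {β : unitInterval}

lemma measureReal_eq_succ_of_map_eq_geomLaw (hβ : β ≠ 0) {X : Ω → ℕ} (hX : Measurable X)
    (hlaw : μ.map X = geomLaw β) (m : ℕ) :
    μ.real {ω | X ω = m + 1} = (1 - β : ℝ) ^ m * β := by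
  have h1 : {ω | X ω = m + 1} = X ⁻¹' {m + 1} := rfl
  rw [h1, ← map_measureReal_apply hX (measurableSet_singleton _), hlaw, geomLaw,
    map_measureReal_apply (by fun_prop) (measurableSet_singleton _)]
  have h2 : (fun k : ℕ => k + 1) ⁻¹' {m + 1} = {m} := by ext k; simp
  rw [h2, geometricMeasure_real_singleton hβ]

lemma ae_pos_of_map_eq_geomLaw {X : Ω → ℕ} (hX : Measurable X)
    (hlaw : μ.map X = geomLaw β) : ∀ᵐ ω ∂μ, 0 < X ω := by
  refine ae_of_ae_map (p := fun n => 0 < n) hX.aemeasurable ?_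
  rw [hlaw, geomLaw, ae_map_iff (by fun_prop) (measurableSet_Ioi (a := 0))]
  exact ae_of_all _ fun k => k.succ_pos

variable [IsProbabilityMeasure μ]

lemma measureReal_lt_of_map_eq_geomLaw (hβ : β ≠ 0) {X : Ω → ℕ} (hX : Measurable X)
    (hlaw : μ.map X = geomLaw β) (m : ℕ) :
    μ.real {ω | m < X ω} = (1 - β : ℝ) ^ m := by
  induction m with
  | zero =>
    rw [pow_zero, ← probReal_univ (μ := μ)]
    refine measureReal_congr ?_
    filter_upwards [ae_pos_of_map_eq_geomLaw hX hlaw] with ω hω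
    exact propext ⟨fun _ => trivial, fun _ => hω⟩
  | succ m ih =>
    have h1 : {ω | m < X ω} = {ω | X ω = m + 1} ∪ {ω | m + 1 < X ω} := by
      ext ω
      simp only [Set.mem_ofPred_eq, Set.mem_union]
      omega
    have h2 : Disjoint {ω | X ω = m + 1} {ω | m + 1 < X ω} :=
      Set.disjoint_left.2 fun ω (h : X ω = m + 1) (h' : m + 1 < X ω) => by omega
    rw [h1, measureReal_union h2 (measurableSet_lt measurable_const hX),
      measureReal_eq_succ_of_map_eq_geomLaw hβ hX hlaw] at ih
    rw [pow_succ]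
    linarith

/-- The memoryless property in the form needed for the renewal set: conditionally on `m < Δ 0`, the
times after `m` avoid the immigration times independently of each other, each with probability
`1 - β`. By induction on the number of times: either `Δ 0 = m + 1` and the sequence starts afresh,
or `m + 1 < Δ 0`. -/
lemma measureReal_lt_inter_notMem_immigrationTimes (hβ : β ≠ 0) (n : ℕ) :
    ∀ (m : ℕ) (Δ : ℕ → Ω → ℕ) (p : ℕ → Prop) [DecidablePred p], (∀ i, Measurable (Δ i)) →
      (∀ i, μ.map (Δ i) = geomLaw β) → iIndepFun Δ μ →
      μ.real ({ω | m < Δ 0 ω} ∩ {ω | ∀ i < n, p i → m + 1 + i ∉ immigrationTimes Δ ω})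
        = (1 - β : ℝ) ^ m * ∏ i ∈ Finset.range n, if p i then (1 - β : ℝ) else 1 := by
  induction n with
  | zero =>
    intro m Δ p _ hm hlaw _
    simpa using measureReal_lt_of_map_eq_geomLaw hβ (hm 0) (hlaw 0) m
  | succ n ih =>
    intro m Δ p _ hm hlaw hind
    set S := {ω | m < Δ 0 ω} ∩ {ω | ∀ i < n + 1, p i → m + 1 + i ∉ immigrationTimes Δ ω} with hS
    have hE : MeasurableSet {ω | Δ 0 ω = m + 1} := hm 0 (measurableSet_singleton (m + 1))
    rw [← measureReal_inter_add_sdiff hE (s := S), Finset.prod_range_succ']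
    have hdiff : S \ {ω | Δ 0 ω = m + 1} = {ω | m + 1 < Δ 0 ω} ∩
        {ω | ∀ i < n, p (i + 1) → m + 1 + 1 + i ∉ immigrationTimes Δ ω} := by
      ext ω
      simp only [hS, Set.mem_sdiff, Set.mem_inter_iff, Set.mem_ofPred_eq]
      constructor
      · rintro ⟨⟨h1, h2⟩, h3⟩
        exact ⟨by omega, fun i hi hp => by
          have := h2 (i + 1) (by omega) hp
          rwa [show m + 1 + (i + 1) = m + 1 + 1 + i by omega] at this⟩
      · rintro ⟨h1, h2⟩
        refine ⟨⟨by omega, fun i hi hp => ?_⟩, by omega⟩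
        cases i with
        | zero => exact fun h => by have := le_of_mem_immigrationTimes h; omega
        | succ i =>
          have := h2 i (by omega) hp
          rwa [show m + 1 + (i + 1) = m + 1 + 1 + i by omega]
    rw [hdiff, ih (m + 1) Δ (fun i => p (i + 1)) hm hlaw hind]
    have hinter : μ.real (S ∩ {ω | Δ 0 ω = m + 1})
        = if p 0 then 0 else (1 - β : ℝ) ^ m * β *
          ∏ i ∈ Finset.range n, if p (i + 1) then (1 - β : ℝ) else 1 := by
      split_ifs with hp0
      · have : S ∩ {ω | Δ 0 ω = m + 1} = ∅ := by
          ext ω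
          simp only [hS, Set.mem_inter_iff, Set.mem_ofPred_eq, Set.mem_empty_iff_false, iff_false]
          rintro ⟨⟨_, h2⟩, h3⟩
          have := h2 0 (by omega) hp0
          rw [add_zero, ← h3] at this
          exact this (mem_immigrationTimes_zero Δ ω)
        rw [this, measureReal_empty]
      · set F := {ω | ∀ i < n, p (i + 1) → 0 + 1 + i ∉ immigrationTimes (fun i => Δ (i + 1)) ω}
          with hF
        have hset : S ∩ {ω | Δ 0 ω = m + 1} = {ω | Δ 0 ω = m + 1} ∩ F := by
          ext ω
          simp only [hS, hF, Set.mem_inter_iff, Set.mem_ofPred_eq]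
          constructor
          · rintro ⟨⟨_, h2⟩, h3⟩
            refine ⟨h3, fun i hi hp h => h2 (i + 1) (by omega) hp ?_⟩
            rw [← h3, show i + 1 = 0 + 1 + i by omega]
            exact (add_mem_immigrationTimes_iff (by omega)).2 h
          · rintro ⟨h1, h2⟩
            refine ⟨⟨by omega, fun i hi hp h => ?_⟩, h1⟩
            cases i with
            | zero => exact hp0 hp
            | succ i =>
              rw [← h1, show i + 1 = 0 + 1 + i by omega] at h
              exact h2 i (by omega) hp ((add_mem_immigrationTimes_iff (by omega)).1 h)
        have hindep := indep_iSup_of_disjoint (fun i => (hm i).comap_le) hind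
          (S := {0}) (T := Set.Ioi 0) (by simp)
        rw [iSup_singleton] at hindep
        have hFm : MeasurableSet[⨆ i ∈ Set.Ioi 0,
            MeasurableSpace.comap (Δ i) inferInstance] F := by
          have hmeas : ∀ i, Measurable[⨆ i ∈ Set.Ioi 0,
              MeasurableSpace.comap (Δ i) inferInstance] (Δ (i + 1)) := fun i =>
            Measurable.of_comap_le (le_iSup₂_of_le (i + 1) i.succ_pos le_rfl)
          have : F = ⋂ i : ℕ, ⋂ _ : i < n, ⋂ _ : p (i + 1),
              {ω | 0 + 1 + i ∈ immigrationTimes (fun i => Δ (i + 1)) ω}ᶜ := by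
            ext ω
            simp [hF]
          rw [this]
          exact MeasurableSet.iInter fun i => MeasurableSet.iInter fun _ =>
            MeasurableSet.iInter fun _ =>
              (@measurableSet_mem_immigrationTimes Ω (⨆ i ∈ Set.Ioi 0,
                MeasurableSpace.comap (Δ i) inferInstance) _ hmeas _).compl
        have hmul := (Indep_iff _ _ μ).1 hindep {ω | Δ 0 ω = m + 1} F
          ⟨{m + 1}, measurableSet_singleton _, rfl⟩ hFm
        have hIH := ih 0 (fun i => Δ (i + 1)) (fun i => p (i + 1)) (fun i => hm _)
          (fun i => hlaw _) (hind.precomp (g := fun i => i + 1) (add_left_injective 1))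
        have hFae : μ.real F = μ.real ({ω | 0 < Δ (0 + 1) ω} ∩ F) := by
          refine measureReal_congr ?_
          filter_upwards [ae_pos_of_map_eq_geomLaw (hm 1) (hlaw 1)] with ω hω
          exact propext ⟨fun h => ⟨hω, h⟩, fun h => h.2⟩
        rw [hset, measureReal_def, hmul, ENNReal.toReal_mul, ← measureReal_def, ← measureReal_def,
          hFae, hIH, measureReal_eq_succ_of_map_eq_geomLaw hβ (hm 0) (hlaw 0)]
        ring
    rw [hinter]
    split_ifs <;> ring

/-- The steps that are not immigration times are those of a Bernoulli process: they are independent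
events of probability `1 - β`. -/
lemma meas_biInter_notMem_immigrationTimes (hβ : β ≠ 0) {Δ : ℕ → Ω → ℕ}
    (hm : ∀ i, Measurable (Δ i)) (hlaw : ∀ i, μ.map (Δ i) = geomLaw β)
    (hind : iIndepFun Δ μ) (t : Finset ℕ) :
    μ (⋂ i ∈ t, {ω | i + 1 ∉ immigrationTimes Δ ω}) = ENNReal.ofReal (1 - β) ^ t.card := by
  obtain ⟨n, hn⟩ := t.exists_nat_subset_range
  have h := measureReal_lt_inter_notMem_immigrationTimes (μ := μ) hβ n 0 Δ (· ∈ t)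
    hm hlaw hind
  have hfil : (Finset.range n).filter (· ∈ t) = t := by
    ext i
    simpa using fun hi => Finset.mem_range.1 (hn hi)
  rw [pow_zero, one_mul, Finset.prod_ite, Finset.prod_const_one, mul_one, Finset.prod_const,
    hfil] at h
  rw [← ENNReal.ofReal_pow (sub_nonneg.2 β.2.2), ← h, ofReal_measureReal]
  refine measure_congr ?_
  filter_upwards [ae_pos_of_map_eq_geomLaw (hm 0) (hlaw 0)] with ω hω
  refine propext ⟨fun h' => ⟨hω, fun i _ hi => ?_⟩, fun h' => ?_⟩
  · have h' : ω ∈ ⋂ i ∈ t, {ω | i + 1 ∉ immigrationTimes Δ ω} := h'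
    rw [show 0 + 1 + i = i + 1 by omega]
    exact Set.mem_iInter₂.1 h' i hi
  · refine Set.mem_iInter₂.2 fun i hi => ?_
    have := h'.2 i (Finset.mem_range.1 (hn hi)) hi
    rwa [show 0 + 1 + i = i + 1 by omega] at this

lemma measure_notMem_immigrationTimes (hβ : β ≠ 0) {Δ : ℕ → Ω → ℕ}
    (hm : ∀ i, Measurable (Δ i)) (hlaw : ∀ i, μ.map (Δ i) = geomLaw β)
    (hind : iIndepFun Δ μ) (n : ℕ) :
    μ {ω | n + 1 ∉ immigrationTimes Δ ω} = ENNReal.ofReal (1 - β) := by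
  simpa using meas_biInter_notMem_immigrationTimes hβ hm hlaw hind {n}

lemma iIndepSet_notMem_immigrationTimes (hβ : β ≠ 0) {Δ : ℕ → Ω → ℕ}
    (hm : ∀ i, Measurable (Δ i)) (hlaw : ∀ i, μ.map (Δ i) = geomLaw β)
    (hind : iIndepFun Δ μ) : iIndepSet (fun n => {ω | n + 1 ∉ immigrationTimes Δ ω}) μ := by
  refine (iIndepSet_iff_meas_biInter
    fun n => (measurableSet_mem_immigrationTimes hm (n + 1)).compl).2 fun t => ?_
  change μ (⋂ i ∈ t, {ω | i + 1 ∉ immigrationTimes Δ ω})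
    = ∏ i ∈ t, μ {ω | i + 1 ∉ immigrationTimes Δ ω}
  rw [meas_biInter_notMem_immigrationTimes hβ hm hlaw hind,
    Finset.prod_congr rfl fun i _ => measure_notMem_immigrationTimes hβ hm hlaw hind i,
    Finset.prod_const]

end Immigration

/-! ### The number of white balls as a Markov chain -/

section FutureImmigration

variable {Ω : Type*} {Δ W B : ℕ → Ω → ℕ}

/-- The `σ`-algebra generated by the events that the steps `n + 1, n + 2, …` are immigration
times. -/
@[reducible]
def futureImmigration (Δ : ℕ → Ω → ℕ) (n : ℕ) : MeasurableSpace Ω :=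
  MeasurableSpace.generateFrom
    {t | ∃ k ∈ Set.Ici n, {ω | k + 1 ∉ immigrationTimes Δ ω} = t}

lemma futureImmigration_le_urnHistory (n k : ℕ) :
    futureImmigration Δ n ≤ urnHistory Δ W B k := by
  refine MeasurableSpace.generateFrom_le ?_
  rintro _ ⟨i, _, rfl⟩
  have hΔ : ∀ i, Measurable[urnHistory Δ W B k] (Δ i) := fun i =>
    Measurable.of_comap_le (le_sup_of_le_left (le_iSup (fun i => MeasurableSpace.comap (Δ i) _) i))
  exact (@measurableSet_mem_immigrationTimes Ω (urnHistory Δ W B k) Δ hΔ (i + 1)).compl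

lemma measurableSet_futureImmigration (n : ℕ) :
    MeasurableSet[futureImmigration Δ n] {ω | n + 1 ∉ immigrationTimes Δ ω} :=
  MeasurableSpace.measurableSet_generateFrom ⟨n, Set.self_mem_Ici, rfl⟩

lemma futureImmigration_succ_le (n : ℕ) :
    futureImmigration Δ (n + 1) ≤ futureImmigration Δ n :=
  MeasurableSpace.generateFrom_mono
    fun _ ⟨k, hk, hs⟩ => ⟨k, (Nat.le_succ n).trans hk, hs⟩

end FutureImmigration

namespace IsImmigrationUrn

variable {Ω : Type*} [m : MeasurableSpace Ω] {μ : Measure Ω} {ν : Measure ℕ} {w b : ℕ}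
  {Δ W B : ℕ → Ω → ℕ}

/-- The natural filtration of the number of white balls. -/
noncomputable def whiteFiltration (h : IsImmigrationUrn μ ν w b Δ W B) : Filtration ℕ m :=
  Filtration.natural W fun n => (h.measurable_white n).stronglyMeasurable

lemma ae_total (h : IsImmigrationUrn μ ν w b Δ W B) (n : ℕ) :
    ∀ᵐ ω ∂μ, W n ω + B n ω = n + (w + b) := by
  induction n with
  | zero => filter_upwards [h.initial] with ω hω; omega
  | succ n ih =>
    filter_upwards [ih, h.immigration_step n, h.draw_step n] with ω h1 h2 h3
    by_cases hω : n + 1 ∈ immigrationTimes Δ ω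
    · have := h2 hω; omega
    · have := h3 hω; omega

lemma ae_step (h : IsImmigrationUrn μ ν w b Δ W B) (n : ℕ) :
    ∀ᵐ ω ∂μ, W (n + 1) ω = W n ω + 1 ∨ W (n + 1) ω = W n ω := by
  filter_upwards [h.immigration_step n, h.draw_step n] with ω h2 h3
  by_cases hω : n + 1 ∈ immigrationTimes Δ ω
  · exact Or.inr (h2 hω).1
  · exact (h3 hω).imp And.left And.left

lemma measurable_whiteFiltration (h : IsImmigrationUrn μ ν w b Δ W B) {k n : ℕ} (hkn : k ≤ n) :
    Measurable[h.whiteFiltration n] (W k) :=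
  Measurable.of_comap_le (le_iSup₂_of_le k hkn le_rfl)

lemma urnHistory_le (h : IsImmigrationUrn μ ν w b Δ W B) (n : ℕ) : urnHistory Δ W B n ≤ m :=
  sup_le (iSup_le fun i => (h.measurable_interarrival i).comap_le)
    (iSup₂_le fun k _ =>
      sup_le (h.measurable_white k).comap_le (h.measurable_black k).comap_le)

lemma whiteFiltration_le_urnHistory (h : IsImmigrationUrn μ ν w b Δ W B) (n : ℕ) :
    h.whiteFiltration n ≤ urnHistory Δ W B n :=
  iSup₂_le fun k hk => le_sup_of_le_right (le_iSup₂_of_le k hk le_sup_left)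

variable [IsProbabilityMeasure μ]

/-- The probability of a white draw, jointly with events of the past and of future immigration, as
long as these are independent. -/
lemma measureReal_inter_inter_draw (h : IsImmigrationUrn μ ν w b Δ W B) {n : ℕ}
    (hind : Indep (h.whiteFiltration n) (futureImmigration Δ n) μ) {A C : Set Ω}
    (hA : MeasurableSet[h.whiteFiltration n] A) (hC : MeasurableSet[futureImmigration Δ n] C) :
    μ.real (A ∩ C ∩ {ω | W (n + 1) ω = W n ω + 1})
      = μ.real (C ∩ {ω | n + 1 ∉ immigrationTimes Δ ω})
        * ∫ ω in A, (W n ω : ℝ) / (n + (w + b)) ∂μ := by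
  set D := {ω | W (n + 1) ω = W n ω + 1} with hD
  set J := {ω | n + 1 ∉ immigrationTimes Δ ω} with hJ
  let f : Ω → ℝ := fun ω => (W n ω : ℝ) / (n + (w + b))
  have hDm : MeasurableSet D := measurableSet_eq_fun (h.measurable_white (n + 1))
    ((measurable_of_countable (· + 1)).comp (h.measurable_white n))
  have hJf : MeasurableSet[futureImmigration Δ n] J := measurableSet_futureImmigration n
  have hFle : futureImmigration Δ n ≤ m :=
    (futureImmigration_le_urnHistory n n).trans (h.urnHistory_le n)
  have hACu : MeasurableSet[urnHistory Δ W B n] (A ∩ C) :=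
    (h.whiteFiltration_le_urnHistory n _ hA).inter (futureImmigration_le_urnHistory n n _ hC)
  have hAm : MeasurableSet A := (h.whiteFiltration).le n _ hA
  have hfm : StronglyMeasurable[h.whiteFiltration n] f :=
    ((measurable_of_countable fun x : ℕ => (x : ℝ) / (n + (w + b))).comp
      (h.measurable_whiteFiltration le_rfl)).stronglyMeasurable
  have hgm : StronglyMeasurable[h.whiteFiltration n] (A.indicator f) := hfm.indicator hA
  have hfint : Integrable f μ := by
    refine Integrable.mono' (integrable_const 1)
      (hfm.mono (h.whiteFiltration.le n)).aestronglyMeasurable ?_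
    filter_upwards [h.ae_total n] with ω hω
    have hω' : (W n ω : ℝ) + B n ω = n + (w + b) := by exact_mod_cast hω
    rw [Real.norm_of_nonneg (by positivity)]
    exact div_le_one_of_le₀ (by rw [← hω']; simp) (by positivity)
  calc μ.real (A ∩ C ∩ D) = ∫ ω in A ∩ C, D.indicator (fun _ => (1 : ℝ)) ω ∂μ := by
        rw [setIntegral_indicator hDm, setIntegral_const, smul_eq_mul, mul_one]
    _ = ∫ ω in A ∩ C, J.indicator (fun ω => (W n ω : ℝ) / ((W n ω : ℝ) + (B n ω : ℝ))) ω ∂μ := by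
        rw [← setIntegral_condExp (h.urnHistory_le n) ((integrable_const 1).indicator hDm) hACu]
        exact setIntegral_congr_ae (h.urnHistory_le n _ hACu)
          ((h.draw_prob n).mono fun ω hω _ => hω)
    _ = ∫ ω in A ∩ C, J.indicator f ω ∂μ := by
        refine setIntegral_congr_ae (h.urnHistory_le n _ hACu) ?_
        filter_upwards [h.ae_total n] with ω hω _
        have hω' : (W n ω : ℝ) + B n ω = n + (w + b) := by exact_mod_cast hω
        by_cases hωJ : ω ∈ J <;> simp [hωJ, f, hω']
    _ = ∫ ω in C ∩ J, A.indicator f ω ∂μ := by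
        rw [setIntegral_indicator (hFle _ hJf), setIntegral_indicator hAm]
        congr 2
        rw [Set.inter_assoc, Set.inter_comm]
    _ = ∫ ω in C ∩ J, (μ[A.indicator f | futureImmigration Δ n]) ω ∂μ :=
        (setIntegral_condExp hFle (hfint.indicator hAm) (hC.inter hJf)).symm
    _ = ∫ ω in C ∩ J, (∫ x, A.indicator f x ∂μ) ∂μ :=
        setIntegral_congr_ae (hFle _ (hC.inter hJf))
          ((condExp_indep_eq (h.whiteFiltration.le n) hFle hgm hind).mono fun ω hω _ => hω)
    _ = _ := by rw [setIntegral_const, smul_eq_mul, integral_indicator hAm]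

end IsImmigrationUrn

namespace IsImmigrationUrn

variable {Ω : Type*} [m : MeasurableSpace Ω] {μ : Measure Ω} [IsProbabilityMeasure μ]
  {β : unitInterval} {w b : ℕ} {Δ W B : ℕ → Ω → ℕ}

/-- The evolution of the number of white balls up to time `n` is independent of the immigration
after time `n`: the draws only depend on the immigration up to time `n`, and whether the steps are
immigration times is a Bernoulli process. -/
lemma indep_whiteFiltration (h : IsImmigrationUrn μ (geomLaw β) w b Δ W B) (hβ : β ≠ 0) (n : ℕ) :
    Indep (h.whiteFiltration n) (futureImmigration Δ n) μ := by
  have hFle : ∀ n, futureImmigration Δ n ≤ m := fun n =>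
    (futureImmigration_le_urnHistory n n).trans (h.urnHistory_le n)
  induction n with
  | zero =>
    rw [Indep_iff]
    intro A C hA hC
    rw [whiteFiltration, Filtration.natural_eq_comap] at hA
    obtain ⟨S, _, rfl⟩ := hA
    -- the initial composition is deterministic
    by_cases hS : (fun _ : Set.Iic 0 => w) ∈ S
    · have : (fun ω (j : Set.Iic 0) => W j ω) ⁻¹' S =ᵐ[μ] Set.univ := by
        filter_upwards [h.initial] with ω hω
        refine propext ⟨fun _ => trivial, fun _ => ?_⟩
        have e : (fun j : Set.Iic 0 => W j ω) = fun _ => w :=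
          funext fun j => by rw [Nat.le_zero.1 j.2, hω.1]
        change (fun j : Set.Iic 0 => W j ω) ∈ S
        rwa [e]
      rw [measure_congr (this.inter (ae_eq_refl C)), measure_congr this]
      simp
    · have : (fun ω (j : Set.Iic 0) => W j ω) ⁻¹' S =ᵐ[μ] (∅ : Set Ω) := by
        filter_upwards [h.initial] with ω hω
        refine propext ⟨fun hω' => ?_, fun h => h.elim⟩
        have e : (fun j : Set.Iic 0 => W j ω) = fun _ => w :=
          funext fun j => by rw [Nat.le_zero.1 j.2, hω.1]
        change (fun j : Set.Iic 0 => W j ω) ∈ S at hω'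
        exact hS (by rwa [e] at hω')
      rw [measure_congr (this.inter (ae_eq_refl C)), measure_congr this]
      simp
  | succ n ih =>
    set D := {ω | W (n + 1) ω = W n ω + 1} with hD
    have hDm : MeasurableSet D := measurableSet_eq_fun (h.measurable_white (n + 1))
      ((measurable_of_countable (· + 1)).comp (h.measurable_white n))
    rw [Indep_iff]
    intro A C hA hC
    have hAm : MeasurableSet A := h.whiteFiltration.le (n + 1) _ hA
    have hCn := futureImmigration_succ_le n _ hC
    -- on the event of a white draw, and off it, `A` coincides with an event of the past
    obtain ⟨A₁, A₂, hA₁, hA₂, hAD, hAD'⟩ : ∃ A₁ A₂ : Set Ω,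
        MeasurableSet[h.whiteFiltration n] A₁ ∧ MeasurableSet[h.whiteFiltration n] A₂ ∧
        (A ∩ D : Set Ω) =ᵐ[μ] (A₁ ∩ D : Set Ω) ∧ (A \ D : Set Ω) =ᵐ[μ] (A₂ \ D : Set Ω) := by
      rw [whiteFiltration, Filtration.natural_eq_comap] at hA
      obtain ⟨S, hS, rfl⟩ := hA
      let φ : ℕ → Ω → Set.Iic (n + 1) → ℕ := fun c ω j =>
        if (j : ℕ) = n + 1 then W n ω + c else W j ω
      have hφ : ∀ c, Measurable[h.whiteFiltration n] (φ c) := fun c => by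
        refine @measurable_pi_lambda _ _ _ (h.whiteFiltration n) _ _ fun j => ?_
        by_cases hj : (j : ℕ) = n + 1
        · simp only [φ, hj, if_true]
          exact (measurable_of_countable (· + c)).comp (h.measurable_whiteFiltration le_rfl)
        · simp only [φ, hj, if_false]
          exact h.measurable_whiteFiltration (Nat.lt_succ_iff.1 (lt_of_le_of_ne j.2 hj))
      have hφW : ∀ c ω, W (n + 1) ω = W n ω + c →
          (fun j : Set.Iic (n + 1) => W j ω) = φ c ω := fun c ω hω => by
        funext j
        by_cases hj : (j : ℕ) = n + 1
        · simp only [φ, hj, if_true, hω]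
        · simp only [φ, hj, if_false]
      refine ⟨φ 1 ⁻¹' S, φ 0 ⁻¹' S, hφ 1 hS, hφ 0 hS, ?_, ?_⟩
      · refine Eventually.of_forall fun ω => propext (and_congr_left fun hω => ?_)
        have := hφW 1 ω hω
        exact iff_of_eq (congrArg (· ∈ S) this)
      · filter_upwards [h.ae_step n] with ω hω
        refine propext (and_congr_left fun hωD => ?_)
        have := hφW 0 ω (hω.resolve_left hωD)
        exact iff_of_eq (congrArg (· ∈ S) this)
    have hsplit : ∀ E, MeasurableSet[futureImmigration Δ n] E → μ.real (A ∩ E)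
        = μ.real (A₁ ∩ E ∩ D) + (μ.real (A₂ ∩ E) - μ.real (A₂ ∩ E ∩ D)) := fun E hE => by
      have e1 : μ.real (A ∩ E ∩ D) = μ.real (A₁ ∩ E ∩ D) := by
        rw [Set.inter_right_comm, Set.inter_right_comm A₁]
        exact measureReal_congr (hAD.inter (ae_eq_refl E))
      have e2 : μ.real ((A ∩ E) \ D) = μ.real ((A₂ ∩ E) \ D) := by
        rw [Set.inter_sdiff_right_comm, Set.inter_sdiff_right_comm (s := A₂)]
        exact measureReal_congr (hAD'.inter (ae_eq_refl E))
      rw [← measureReal_inter_add_sdiff hDm (s := A ∩ E), e1, e2,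
        ← measureReal_inter_add_sdiff hDm (s := A₂ ∩ E)]
      ring
    have hindJ := iIndepSet.indep_generateFrom_of_disjoint
      (fun k => (measurableSet_mem_immigrationTimes h.measurable_interarrival (k + 1)).compl)
      (iIndepSet_notMem_immigrationTimes hβ h.measurable_interarrival h.interarrival_law
        h.interarrival_indep) (Set.Ici (n + 1)) {n} (by simp)
    have hCJ : μ.real (C ∩ {ω | n + 1 ∉ immigrationTimes Δ ω})
        = μ.real C * μ.real {ω | n + 1 ∉ immigrationTimes Δ ω} := by
      rw [measureReal_def, (Indep_iff _ _ μ).1 hindJ C {ω | n + 1 ∉ immigrationTimes Δ ω} hC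
        (MeasurableSpace.measurableSet_generateFrom ⟨n, rfl, rfl⟩), ENNReal.toReal_mul]
      rfl
    have hmain : μ.real (A ∩ C) = μ.real A * μ.real C := by
      have hC2 : μ.real (A₂ ∩ C) = μ.real A₂ * μ.real C := by
        rw [measureReal_def, (Indep_iff _ _ μ).1 ih A₂ C hA₂ hCn, ENNReal.toReal_mul]
        rfl
      have hu := hsplit Set.univ MeasurableSet.univ
      rw [h.measureReal_inter_inter_draw ih hA₁ MeasurableSet.univ,
        h.measureReal_inter_inter_draw ih hA₂ MeasurableSet.univ, Set.univ_inter,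
        Set.inter_univ, Set.inter_univ] at hu
      rw [hsplit C hCn, h.measureReal_inter_inter_draw ih hA₁ hCn,
        h.measureReal_inter_inter_draw ih hA₂ hCn, hCJ, hC2, hu]
      ring
    rw [← ENNReal.toReal_eq_toReal_iff' (measure_ne_top _ _)
      (ENNReal.mul_ne_top (measure_ne_top _ _) (measure_ne_top _ _)), ENNReal.toReal_mul]
    exact hmain

/-- Averaged over immigration, a white ball is added with probability `1 - β` times the proportion
of white balls, independently of everything but the current number of white balls. -/
theorem isLinearGrowth (h : IsImmigrationUrn μ (geomLaw β) w b Δ W B) (hβ : β ≠ 0) :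
    IsLinearGrowth μ h.whiteFiltration (1 - β) (w + b) w W := by
  refine ⟨fun n => h.measurable_whiteFiltration le_rfl, h.initial.mono fun ω hω => hω.1,
    h.ae_step, fun n => ?_⟩
  set D := {ω | W (n + 1) ω = W n ω + 1} with hD
  have hDm : MeasurableSet D := measurableSet_eq_fun (h.measurable_white (n + 1))
    ((measurable_of_countable (· + 1)).comp (h.measurable_white n))
  have hfm : StronglyMeasurable[h.whiteFiltration n]
      (fun ω => (1 - β : ℝ) * W n ω / (n + (w + b))) :=
    ((measurable_of_countable fun x : ℕ => (1 - β : ℝ) * x / (n + (w + b))).comp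
      (h.measurable_whiteFiltration le_rfl)).stronglyMeasurable
  have hfint : Integrable (fun ω => (1 - β : ℝ) * W n ω / (n + (w + b))) μ := by
    refine Integrable.mono' (integrable_const 1)
      (hfm.mono (h.whiteFiltration.le n)).aestronglyMeasurable ?_
    filter_upwards [h.ae_total n] with ω hω
    have hω' : (W n ω : ℝ) + B n ω = n + (w + b) := by exact_mod_cast hω
    have h0 : (0 : ℝ) ≤ 1 - β := sub_nonneg.2 β.2.2
    rw [Real.norm_of_nonneg (by positivity)]
    refine div_le_one_of_le₀ ?_ (by positivity)
    calc (1 - β : ℝ) * W n ω ≤ 1 * W n ω := by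
          gcongr
          exact sub_le_self _ β.2.1
      _ ≤ n + (w + b) := by rw [← hω']; simp
  refine (ae_eq_condExp_of_forall_setIntegral_eq (h.whiteFiltration.le n)
    ((integrable_const 1).indicator hDm) (fun _ _ _ => hfint.integrableOn) (fun A hA _ => ?_)
    hfm.aestronglyMeasurable).symm
  have hdraw := h.measureReal_inter_inter_draw (h.indep_whiteFiltration hβ n) hA
    MeasurableSet.univ
  rw [Set.inter_univ, Set.univ_inter, measureReal_def (s := {ω | n + 1 ∉ immigrationTimes Δ ω}),
    measure_notMem_immigrationTimes hβ h.measurable_interarrival h.interarrival_law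
      h.interarrival_indep, ENNReal.toReal_ofReal (sub_nonneg.2 β.2.2)] at hdraw
  rw [setIntegral_indicator hDm, setIntegral_const, smul_eq_mul, mul_one, hdraw,
    ← integral_const_mul]
  simp_rw [mul_div_assoc]

end IsImmigrationUrn

/-! ### The law of the limit -/

lemma beta_moment_nonneg {a c : ℝ} (ha : 0 < a) (hc : 0 < c) (k : ℕ) :
    0 ≤ Real.Gamma (a + k) * Real.Gamma (a + c) / (Real.Gamma a * Real.Gamma (a + c + k)) := by
  have := Real.Gamma_pos_of_pos (show 0 < a + k by positivity)
  have := Real.Gamma_pos_of_pos (show 0 < a + c by positivity)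
  have := Real.Gamma_pos_of_pos ha
  have := Real.Gamma_pos_of_pos (show 0 < a + c + k by positivity)
  positivity

/-- The moments of the limit grow slowly enough to determine its law. -/
lemma summable_limit_moments {w : ℕ} {s σ : ℝ} (hw : 0 < w) (hs : 2 ≤ s) (hσ : 0 ≤ σ) :
    Summable fun k : ℕ => (1 / 2 : ℝ) ^ k / k.factorial *
      (Real.Gamma (w + k) / Real.Gamma w * (Real.Gamma s / Real.Gamma (s + σ * k))) := by
  have hw' : (0 : ℝ) < w := by exact_mod_cast hw
  have hpos : ∀ k : ℕ, 0 ≤ (1 / 2 : ℝ) ^ k / k.factorial *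
      (Real.Gamma (w + k) / Real.Gamma w) := fun k => by
    have := Real.Gamma_pos_of_pos (show 0 < (w : ℝ) + k by positivity)
    have := Real.Gamma_pos_of_pos hw'
    positivity
  have hΓs := Real.Gamma_pos_of_pos (show 0 < s by linarith)
  refine Summable.of_nonneg_of_le (fun k => ?_) (fun k => ?_) (summable_gamma_moments hw)
  · rw [← mul_assoc]
    have := Real.Gamma_pos_of_pos (show 0 < s + σ * k by positivity)
    exact mul_nonneg (hpos k) (by positivity)
  · rw [← mul_assoc]
    refine mul_le_of_le_one_right (hpos k) (div_le_one_of_le₀ ?_ ?_)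
    · have hk : 0 ≤ σ * k := by positivity
      exact Real.Gamma_strictMonoOn_Ici.monotoneOn hs (show 2 ≤ s + σ * k by linarith)
        (by linarith)
    · exact (Real.Gamma_pos_of_pos (by positivity)).le

theorem proposition19 {Ω : Type*} [MeasurableSpace Ω] (μ : Measure Ω) [IsProbabilityMeasure μ]
    (β : ℝ) (hβ0 : 0 < β) (hβ1 : β < 1) (w b : ℕ) (hw : 0 < w) (hb : 0 < b)
    (Δ W B : ℕ → Ω → ℕ)
    (hurn : IsImmigrationUrn μ (geomLaw ⟨β, hβ0.le, hβ1.le⟩) w b Δ W B) :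
    ∃ ξ : Ω → ℝ, Measurable ξ ∧
      (∀ᵐ ω ∂μ,
        Tendsto (fun n : ℕ => (n : ℝ) ^ (-(1 - β)) * (W n ω : ℝ)) atTop (𝓝 (ξ ω))) ∧
      -- the laws of products of independent variables are multiplicative convolutions
      μ.map ξ =
        (betaMeasure (w : ℝ) (b : ℝ)).mconv
          ((betaMeasure ((w : ℝ) + b) (((w : ℝ) + b - 1) * (β / (1 - β)))).mconv
            (mittagLefflerLaw (1 - β) ((w : ℝ) + b - 1))) ∧
      μ.map ξ =
        (betaMeasure (w : ℝ) ((((w : ℝ) - 1) * β + b) / (1 - β))).mconv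
          (mittagLefflerLaw (1 - β) ((w : ℝ) + b - 1)) ∧
      μ.map ξ =
        (betaMeasure (w : ℝ) (((w : ℝ) * β + b) / (1 - β))).mconv
          (mittagLefflerLaw (1 - β) ((w : ℝ) + b)) ∧
      (μ.map ξ).mconv ((gammaMeasure ((w : ℝ) + b) 1).map (fun x => x ^ (1 - β))) =
        gammaMeasure (w : ℝ) 1 := by
  have hw1 : (1 : ℝ) ≤ w := by exact_mod_cast hw
  have hb1 : (1 : ℝ) ≤ b := by exact_mod_cast hb
  have hw0 : (0 : ℝ) < w := by linarith
  have hb0 : (0 : ℝ) < b := by linarith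
  have hσ0 : 0 < 1 - β := by linarith
  have hσ1 : 1 - β < 1 := by linarith
  have hs0 : (0 : ℝ) < w + b := by linarith
  have hθ0 : (0 : ℝ) < w + b - 1 := by linarith
  have hβ : (⟨β, hβ0.le, hβ1.le⟩ : unitInterval) ≠ 0 := fun h => hβ0.ne' (congrArg Subtype.val h)
  have hgrow := hurn.isLinearGrowth hβ
  obtain ⟨ξ, hξm, hξ⟩ := hgrow.exists_tendsto hσ0.le hs0
  have hmom := hgrow.hasMoments_limit hσ0 hs0 hw hξm hξ
  simp only at hmom
  have huniq : ∀ {ν : Measure ℝ} {m : ℕ → ℝ}, HasMoments ν m →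
      (∀ k : ℕ, m k = Real.Gamma (w + k) / Real.Gamma w
        * (Real.Gamma (w + b) / Real.Gamma (w + b + (1 - β) * k))) → μ.map ξ = ν :=
    fun hν hm => hmom.ext (hν.congr hm) (by norm_num)
      (summable_limit_moments hw (by linarith) hσ0.le)
  have hΓw := Real.Gamma_pos_of_pos hw0
  have hΓs := Real.Gamma_pos_of_pos hs0
  have hΓ : ∀ k : ℕ, 0 < Real.Gamma (w + b + (1 - β) * k) := fun k =>
    Real.Gamma_pos_of_pos (by positivity)
  refine ⟨ξ, hξm, hξ, ?_, ?_, ?_, hmom.mconv_gammaMeasure hσ0.le hs0 hw⟩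
  · have hc : 0 < ((w : ℝ) + b - 1) * (β / (1 - β)) := by positivity
    refine huniq ((hasMoments_betaMeasure hw0 hb0).mconv
      ((hasMoments_betaMeasure hs0 hc).mconv (hasMoments_mittagLefflerLaw hσ0 hσ1 hθ0)
        (beta_moment_nonneg hs0 hc)) (beta_moment_nonneg hw0 hb0)) fun k => ?_
    have e1 : (w : ℝ) + b + ((w : ℝ) + b - 1) * (β / (1 - β)) = 1 + (w + b - 1) / (1 - β) := by
      field_simp
      ring
    have e2 : (1 : ℝ) + (w + b - 1 + (1 - β) * k) / (1 - β) = 1 + (w + b - 1) / (1 - β) + k := by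
      field_simp
      ring
    have e3 : (1 : ℝ) + (w + b - 1 + (1 - β) * k) = w + b + (1 - β) * k := by ring
    have e4 : (1 : ℝ) + (w + b - 1) = w + b := by ring
    rw [e1, e2, e3, e4]
    have := hΓ k
    have h1 : 0 < Real.Gamma (1 + (w + b - 1) / (1 - β)) := Real.Gamma_pos_of_pos (by positivity)
    have h2 : 0 < Real.Gamma (1 + (w + b - 1) / (1 - β) + k) :=
      Real.Gamma_pos_of_pos (by positivity)
    have h3 : 0 < Real.Gamma ((w : ℝ) + b + k) := Real.Gamma_pos_of_pos (by positivity)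
    field_simp
  · have hc : 0 < (((w : ℝ) - 1) * β + b) / (1 - β) := by
      have : 0 ≤ ((w : ℝ) - 1) * β := mul_nonneg (by linarith) hβ0.le
      positivity
    refine huniq ((hasMoments_betaMeasure hw0 hc).mconv (hasMoments_mittagLefflerLaw hσ0 hσ1 hθ0)
      (beta_moment_nonneg hw0 hc)) fun k => ?_
    have e1 : (w : ℝ) + (((w : ℝ) - 1) * β + b) / (1 - β) = 1 + (w + b - 1) / (1 - β) := by
      field_simp
      ring
    have e2 : (1 : ℝ) + (w + b - 1 + (1 - β) * k) / (1 - β) = 1 + (w + b - 1) / (1 - β) + k := by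
      field_simp
      ring
    have e3 : (1 : ℝ) + (w + b - 1 + (1 - β) * k) = w + b + (1 - β) * k := by ring
    have e4 : (1 : ℝ) + (w + b - 1) = w + b := by ring
    rw [e1, e2, e3, e4]
    have := hΓ k
    have h1 : 0 < Real.Gamma (1 + (w + b - 1) / (1 - β)) := Real.Gamma_pos_of_pos (by positivity)
    have h2 : 0 < Real.Gamma (1 + (w + b - 1) / (1 - β) + k) :=
      Real.Gamma_pos_of_pos (by positivity)
    field_simp
  · have hc : 0 < ((w : ℝ) * β + b) / (1 - β) := by positivity
    refine huniq ((hasMoments_betaMeasure hw0 hc).mconv (hasMoments_mittagLefflerLaw hσ0 hσ1 hs0)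
      (beta_moment_nonneg hw0 hc)) fun k => ?_
    have e1 : (w : ℝ) + ((w : ℝ) * β + b) / (1 - β) = (w + b) / (1 - β) := by
      field_simp
      ring
    have e2 : (1 : ℝ) + (w + b + (1 - β) * k) / (1 - β) = (w + b) / (1 - β) + k + 1 := by
      field_simp
      ring
    rw [e1, e2, add_comm 1, add_comm 1, add_comm (1 : ℝ), Real.Gamma_add_one (by positivity),
      Real.Gamma_add_one (by positivity), Real.Gamma_add_one (by positivity),
      Real.Gamma_add_one (by positivity)]
    have := hΓ k
    have h1 : 0 < Real.Gamma ((w + b) / (1 - β)) := Real.Gamma_pos_of_pos (by positivity)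
    have h2 : 0 < Real.Gamma ((w + b) / (1 - β) + k) := Real.Gamma_pos_of_pos (by positivity)
    have h3 : (0 : ℝ) < w + b + (1 - β) * k := by positivity
    have h4 : ((w : ℝ) + b) / (1 - β) + k = (w + b + (1 - β) * k) / (1 - β) := by field_simp
    rw [h4] at h2 ⊢
    field_simp
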